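/- **Setting.** Let $G=(V,E)$ be a finite simple directed graph with $n=|V|$ nodes, a source $s$ and a sink $t\neq s$. Every node and every edge has a positive integer capacity and every edge $e$ has a nonnegative integer transit time $d(e)$; let $\tau=\max_{e\in E}d(e)$ and assume $\tau\ge 1$. Initially $p\ge 1$ evacuees are at $s$. A *path* is a simple directed path from $s$ to $t$, and its transit time $T(P)$ is the sum of the transit times of its edges. Fix an arbitrary ranking (strict total order) of the paths. **CCRP.** A *route* is a path together with integer arrival and departure times at its nodes; a group using it enters each edge at the departure time from the tail, reaches the head $d(e)$ time units later, and may wait at intermediate nodes (it starts from $s$ at any time $\ge 0$ and leaves the network on reaching $t$). A group of size $g$ on a route reserves $g$ units of the capacity of each edge of the route at the time of entering it, and $g$ units of the capacity of each node at every time from arrival to departure. While there are evacuees left at $s$, CCRP chooses, among all routes on which all capacities needed are still positive after the previous reservations, one with the earliest arrival time at $t$; ties are broken in favour of smaller $T(P)$, then by the ranking of the paths, then in favour of smaller delay on the way. It reserves this route for a group whose size is the minimum of the number of evacuees left and of the available capacities along the route. The evacuation time $T^{CCRP}_{Evac}$ is the latest arrival time of a group at $t$, and $k$ is the number of distinct paths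 used. **SSEP.** For paths $P_1,\dots,P_i$ with transit times $T_j$ and capacities $C_j$ put $$CET=\left\lceil\frac{p+\sum_{j\le i}C_jT_j}{\sum_{j\le i}C_j}\right\rceil-1 .$$ SSEP starts with no path and $CET=\infty$. While fewer than $p$ paths have been selected and $t$ is reachable from $s$, it takes the path $P$ of smallest transit time in the current residual graph (ties broken by the same ranking), with $C$ the minimum residual capacity of its nodes and edges. If $T(P)\le CET$ for the paths selected so far, $P$ is selected with capacity $C$, the capacities of all its nodes and edges are permanently reduced by $C$, the nodes and edges with no capacity left are deleted, and $CET$ is recomputed; otherwise SSEP stops. The evacuation time $T^{SSEP}_{Evac}$ of its solution is the final value of $CET$; let $k'$ be the number of paths selected. **Theorem.** For any output of CCRP and any output of SSEP on such a network, $$T^{CCRP}_{Evac}\le\left\lfloor\frac pk\right\rfloor+(n-1)\tau-1,\qquad T^{SSEP}_{Evac}\le\left\lfloor\frac pk\right\rfloor+(n-1)\tau-1,\qquad T^{SSEP}_{Evac}\le\left\lfloor\frac p{k'}\right\rfloor+(n-1)\tau-1 .$$ -/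

import Mathlib

/-- A single-source single-sink evacuation network: a finite simple directed graph with
integral positive node and edge capacities and integral transit times. The values of
`edgeCap` and `transit` outside `edgeSet` are irrelevant. -/
structure EvacNetwork (V : Type*) where
  edgeSet : Finset (V × V)
  source : V
  sink : V
  source_ne_sink : source ≠ sink
  nodeCap : V → ℕ
  edgeCap : V × V → ℕ
  transit : V × V → ℕ
  nodeCap_pos : ∀ v, 0 < nodeCap v
  edgeCap_pos : ∀ e ∈ edgeSet, 0 < edgeCap e

/-- The consecutive pairs of a list of nodes, i.e. the edges traversed by the path. -/
def pathEdges {V : Type*} (P : List V) : List (V × V) := P.zip P.tail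

namespace EvacNetwork

variable {V : Type*}

/-- `P` is a simple directed path from the source to the sink. -/
def IsPath (N : EvacNetwork V) (P : List V) : Prop :=
  P.head? = some N.source ∧ P.getLast? = some N.sink ∧ P.Nodup ∧
    ∀ e ∈ pathEdges P, e ∈ N.edgeSet

/-- Transit time of a path. -/
def pathTransit (N : EvacNetwork V) (P : List V) : ℕ := ((pathEdges P).map N.transit).sum

/-- The maximum transit time of an edge. -/
def maxTransit (N : EvacNetwork V) : ℕ := N.edgeSet.sup N.transit

end EvacNetwork

/-- A route: a path together with the times `arr v` and `dep v` at which the people taking it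
arrive at and leave the node `v` (values at nodes off the path are irrelevant). -/
structure EvacRoute (V : Type*) where
  path : List V
  arr : V → ℕ
  dep : V → ℕ

/-- The route keeps node `v` occupied at time `x`. -/
def EvacRoute.UsesNode {V : Type*} (r : EvacRoute V) (v : V) (x : ℕ) : Prop :=
  v ∈ r.path ∧ r.arr v ≤ x ∧ x ≤ r.dep v

/-- The people on the route enter the edge `e` at time `x`. -/
def EvacRoute.UsesEdge {V : Type*} (r : EvacRoute V) (e : V × V) (x : ℕ) : Prop :=
  e ∈ pathEdges r.path ∧ x = r.dep e.1

namespace EvacNetwork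

variable {V : Type*}

/-- `r` is a route of the network. People may wait at intermediate nodes. A group appears on the
network when it starts from the source (before that it belongs to the initial
occupancy of the source) and leaves it on reaching the sink. -/
def IsRoute (N : EvacNetwork V) (r : EvacRoute V) : Prop :=
  N.IsPath r.path ∧ (∀ v ∈ r.path, r.arr v ≤ r.dep v) ∧
    (∀ e ∈ pathEdges r.path, r.arr e.2 = r.dep e.1 + N.transit e) ∧
    r.arr N.source = r.dep N.source ∧ r.arr N.sink = r.dep N.sink

open Classical in
/-- Capacity of node `v` still available at time `x`, given the groups (route and size)
reserved so far. -/
noncomputable def availNode (N : EvacNetwork V) (R : List (EvacRoute V × ℕ)) (v : V) (x : ℕ) : ℕ :=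
  N.nodeCap v - (R.map fun g => if g.1.UsesNode v x then g.2 else 0).sum

open Classical in
/-- Capacity of edge `e` still available for people entering it at time `x`. -/
noncomputable def availEdge (N : EvacNetwork V) (R : List (EvacRoute V × ℕ)) (e : V × V) (x : ℕ) :
    ℕ :=
  N.edgeCap e - (R.map fun g => if g.1.UsesEdge e x then g.2 else 0).sum

/-- The capacities available along the route `r`, subject to the prior reservations `R`. -/
def availAlong (N : EvacNetwork V) (R : List (EvacRoute V × ℕ)) (r : EvacRoute V) : Set ℕ :=
  {c | (∃ v x, r.UsesNode v x ∧ c = N.availNode R v x) ∨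
    (∃ e x, r.UsesEdge e x ∧ c = N.availEdge R e x)}

/-- `r` can be used by at least one more person, subject to the prior reservations `R`. -/
def IsFeasible (N : EvacNetwork V) (R : List (EvacRoute V × ℕ)) (r : EvacRoute V) : Prop :=
  N.IsRoute r ∧ ∀ c ∈ N.availAlong R r, 0 < c

/-- Total delay on the way: arrival time minus starting time minus transit time. -/
def delay (N : EvacNetwork V) (r : EvacRoute V) : ℕ :=
  r.arr N.sink - r.dep N.source - N.pathTransit r.path

/-- What the planner minimizes, lexicographically: the destination arrival time; ties
are broken by the transit time of the path, then by a fixed ranking of the paths, then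
by the delay on the way. -/
def routeKey (N : EvacNetwork V) (rank : List V → ℕ) (r : EvacRoute V) : ℕ ×ₗ ℕ ×ₗ ℕ ×ₗ ℕ :=
  toLex (r.arr N.sink, toLex (N.pathTransit r.path, toLex (rank r.path, N.delay r)))

/-- Total number of people in the groups `R`. -/
def evacuated (R : List (EvacRoute V × ℕ)) : ℕ := (R.map Prod.snd).sum

/-- `R` is the list of groups reserved by CCRP with `p` evacuees after finitely many iterations. -/
inductive CCRPReach (N : EvacNetwork V) (p : ℕ) (rank : List V → ℕ) :
    List (EvacRoute V × ℕ) → Prop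
  | init : CCRPReach N p rank []
  | step (R : List (EvacRoute V × ℕ)) (r : EvacRoute V) (g : ℕ)
      (hR : CCRPReach N p rank R)
      (hleft : evacuated R < p)
      (hfeas : N.IsFeasible R r)
      (hmin : ∀ r', N.IsFeasible R r' → N.routeKey rank r ≤ N.routeKey rank r')
      (hgroup : IsLeast (insert (p - evacuated R) (N.availAlong R r)) g) :
      CCRPReach N p rank (R ++ [(r, g)])

/-- `R` is the evacuation plan returned by CCRP: no evacuee is left at the source. -/
def IsCCRPOutput (N : EvacNetwork V) (p : ℕ) (rank : List V → ℕ)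
    (R : List (EvacRoute V × ℕ)) : Prop :=
  CCRPReach N p rank R ∧ evacuated R = p

/-- Evacuation time of a plan: the time at which the last group reaches the sink. -/
def evacTime (N : EvacNetwork V) (R : List (EvacRoute V × ℕ)) : ℕ :=
  (R.map fun g => g.1.arr N.sink).foldr max 0

/-- Number of distinct paths used by a plan. -/
def numPaths [DecidableEq V] (R : List (EvacRoute V × ℕ)) : ℕ :=
  (R.map fun g => g.1.path).toFinset.card

/-- Combined evacuation time for `p` people on a list of paths with capacities. -/
def CET (N : EvacNetwork V) (p : ℕ) (S : List (List V × ℕ)) : ℤ :=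
  ⌈((p + (S.map fun a => a.2 * N.pathTransit a.1).sum : ℕ) : ℚ) / ((S.map Prod.snd).sum : ℕ)⌉ - 1

open Classical in
/-- Node capacity left once the capacities of all paths in `S` are permanently deducted. -/
noncomputable def residualNode (N : EvacNetwork V) (S : List (List V × ℕ)) (v : V) : ℕ :=
  N.nodeCap v - (S.map fun a => if v ∈ a.1 then a.2 else 0).sum

open Classical in
/-- Edge capacity left once the capacities of all paths in `S` are permanently deducted. -/
noncomputable def residualEdge (N : EvacNetwork V) (S : List (List V × ℕ)) (e : V × V) : ℕ :=
  N.edgeCap e - (S.map fun a => if e ∈ pathEdges a.1 then a.2 else 0).sum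

/-- The residual capacities of the nodes and edges of `P`. -/
def residualAlong (N : EvacNetwork V) (S : List (List V × ℕ)) (P : List V) : Set ℕ :=
  {c | (∃ v ∈ P, c = N.residualNode S v) ∨ (∃ e ∈ pathEdges P, c = N.residualEdge S e)}

/-- `P` is a path of the residual graph, in which the saturated nodes and edges
(those with no capacity left) have been deleted. -/
def IsResidualPath (N : EvacNetwork V) (S : List (List V × ℕ)) (P : List V) : Prop :=
  N.IsPath P ∧ ∀ c ∈ N.residualAlong S P, 0 < c

/-- Transit time of a path, ties being broken by the ranking. -/
def pathKey (N : EvacNetwork V) (rank : List V → ℕ) (P : List V) : ℕ ×ₗ ℕ :=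
  toLex (N.pathTransit P, rank P)

/-- SSEP, having selected the paths with capacities `S`, adds `P` with capacity `C`. -/
structure SSEPStep (N : EvacNetwork V) (p : ℕ) (rank : List V → ℕ) (S : List (List V × ℕ))
    (P : List V) (C : ℕ) : Prop where
  length_lt : S.length < p
  residual : N.IsResidualPath S P
  shortest : ∀ P', N.IsResidualPath S P' → N.pathKey rank P ≤ N.pathKey rank P'
  capacity : IsLeast (N.residualAlong S P) C
  transit_le : S ≠ [] → (N.pathTransit P : ℤ) ≤ N.CET p S

/-- `S` is the list of paths with capacities selected by SSEP after finitely many iterations. -/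
inductive SSEPReach (N : EvacNetwork V) (p : ℕ) (rank : List V → ℕ) : List (List V × ℕ) → Prop
  | init : SSEPReach N p rank []
  | step (S : List (List V × ℕ)) (P : List V) (C : ℕ)
      (hS : SSEPReach N p rank S) (hstep : SSEPStep N p rank S P C) :
      SSEPReach N p rank (S ++ [(P, C)])

/-- `S` is the list of paths with capacities returned by SSEP: no further path is added. The
evacuation time of its solution is the combined evacuation time `N.CET p S`. -/
def IsSSEPOutput (N : EvacNetwork V) (p : ℕ) (rank : List V → ℕ) (S : List (List V × ℕ)) : Prop :=
  SSEPReach N p rank S ∧ ∀ P C, ¬ SSEPStep N p rank S P C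

/-- The bound `⌊p / k⌋ + (n - 1) τ - 1`. -/
def evacBound [Fintype V] (N : EvacNetwork V) (p k : ℕ) : ℤ :=
  ⌊(p : ℚ) / k⌋ + ((Fintype.card V : ℤ) - 1) * N.maxTransit - 1

end EvacNetwork

/-!
Process the paths in the order of transit time and ranking, and let each take the largest amount
`c Q` that the previous ones leave free on its nodes and edges, forever. SSEP selects exactly the
first paths with `c Q > 0`, with these amounts as capacities. CCRP does the same over time: its
`i`-th group travels without delay and has size `c Q`, where `(b, Q)` is the `i`-th pair, in the
order of arrival times and then of paths, with `c Q > 0` and `b` at least the transit time of `Q`;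
only the last group may be smaller. The reason is that, by exchanging parts of paths, a path `Q`
with `c Q > 0` reaches its nodes, and the sink from them, as fast as any path that has capacity
left when `Q` is processed; so a resource which later people want at a given time is wanted at
that very time by everybody who precedes them in the static order.

Let `A m` be the sum of `c Q * (m - T Q)` over the paths with `c Q > 0` and `T Q ≤ m`, the number
of people that can arrive before the time `m`. Then CCRP ends at the time `a` with
`A a < p ≤ A (a + 1)`, and `A CET < p` for SSEP, which is therefore not slower than CCRP. Finally
`A m < p` forces the bound for `m` and any set of paths with `c Q > 0`: their transit times are at
most `(n - 1) τ`, and only the last of them can attain this value, since two Hamiltonian paths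
which visit the nodes at the same times coincide.
-/

section GreedyPrefix

variable {α κ : Type*} [LinearOrder κ] {key : α → κ} {s : Set α} {l : List α} {a : α}

/-- The list `l` consists of the elements of an initial segment of `s`, with respect to the order
given by `key`, without repetitions. The order of the elements within the list is irrelevant. -/
structure IsGreedyPrefix (key : α → κ) (s : Set α) (l : List α) : Prop where
  nodup : l.Nodup
  subset : ∀ a ∈ l, a ∈ s
  lower : ∀ a ∈ l, ∀ b ∈ s, key b ≤ key a → b ∈ l

/-- The element `a` is the one with which a greedy prefix `l` of `s` has to be continued. -/
structure IsGreedyNext (key : α → κ) (s : Set α) (l : List α) (a : α) : Prop where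
  mem : a ∈ s
  mem_iff : ∀ b ∈ s, b ∈ l ↔ key b < key a

lemma IsGreedyNext.notMem (ha : IsGreedyNext key s l a) : a ∉ l :=
  fun hal => lt_irrefl _ ((ha.mem_iff a ha.mem).1 hal)

lemma IsGreedyPrefix.nil : IsGreedyPrefix key s [] where
  nodup := List.nodup_nil
  subset := by simp
  lower := by simp

lemma IsGreedyPrefix.append (h : IsGreedyPrefix key s l) (hkey : Function.Injective key)
    (ha : IsGreedyNext key s l a) : IsGreedyPrefix key s (l ++ [a]) where
  nodup := by simpa using List.nodup_concat l a |>.2 ⟨ha.notMem, h.nodup⟩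
  subset b hb := by
    rcases List.mem_append.1 hb with hb | hb
    · exact h.subset b hb
    · exact List.mem_singleton.1 hb ▸ ha.mem
  lower b hb c hc hcb := by
    rw [List.mem_append, List.mem_singleton]
    rcases List.mem_append.1 hb with hb | hb
    · exact Or.inl (h.lower b hb c hc hcb)
    · rw [List.mem_singleton.1 hb] at hcb
      exact hcb.lt_or_eq.imp (ha.mem_iff c hc).2 fun heq => hkey heq

lemma IsGreedyPrefix.exists_next [WellFoundedLT κ] (h : IsGreedyPrefix key s l)
    (hne : ∃ a ∈ s, a ∉ l) : ∃ a, IsGreedyNext key s l a := by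
  obtain ⟨a, ⟨has, hal⟩, hmin⟩ :=
    exists_minimalFor_of_wellFoundedLT (fun a => a ∈ s ∧ a ∉ l) key hne
  refine ⟨a, has, fun b hb => ⟨fun hbl => ?_, fun hlt => ?_⟩⟩
  · by_contra! hle
    exact hal (h.lower b hbl a has hle)
  · by_contra hbl
    exact (hmin ⟨hb, hbl⟩ hlt.le).not_gt hlt

end GreedyPrefix

/-- Finitely many items, ordered by their keys, compete for resources: an amount `m` of the item `i`
uses `m` units of the capacity of every resource in `support i`. -/
structure PackingSystem (ι ρ κ : Type*) [LinearOrder κ] where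
  items : Finset ι
  key : ι → κ
  key_injective : Function.Injective key
  support : ι → Set ρ
  support_nonempty : ∀ i ∈ items, (support i).Nonempty
  cap : ρ → ℕ
  cap_pos : ∀ i ∈ items, ∀ x ∈ support i, 0 < cap x

namespace PackingSystem

variable {ι ρ κ : Type*} [LinearOrder κ] (G : PackingSystem ι ρ κ)

/-- The set of items that precede `i`. -/
def before (i : ι) : Set ι := {j | G.key j < G.key i}

/-- The set of items that precede or equal `i`. -/
def upto (i : ι) : Set ι := {j | G.key j ≤ G.key i}

open Classical in
/-- The amount of the item `i` that is packed when the items are processed in the order of their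
keys, each one as much as the capacities left by its predecessors allow. -/
noncomputable def amount (i : ι) : ℕ :=
  sInf ((fun x => G.cap x -
    ∑ j ∈ {j ∈ G.items | j ∈ G.before i ∧ x ∈ G.support j}.attach, amount j) '' G.support i)
termination_by {j ∈ G.items | j ∈ G.before i}.card
decreasing_by
  obtain ⟨hj, hji, -⟩ := Finset.mem_filter.1 j.2
  refine Finset.card_lt_card (Finset.ssubset_iff_of_subset ?_ |>.2 ⟨j, ?_, ?_⟩)
  · exact Finset.monotone_filter_right _ fun k _ hk => lt_trans hk hji
  · exact Finset.mem_filter.2 ⟨hj, hji⟩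
  · exact fun h => lt_irrefl _ (Finset.mem_filter.1 h).2

open Classical in
/-- The capacity of the resource `x` that the greedy packing uses for the items in `D`. -/
noncomputable def used (D : Set ι) (x : ρ) : ℕ :=
  ∑ i ∈ G.items with i ∈ D ∧ x ∈ G.support i, G.amount i

open Classical in
/-- The items that occur in the greedy packing. -/
noncomputable def selected : Finset ι := {i ∈ G.items | 0 < G.amount i}

/-- When the greedy packing uses its capacities for the items in `D` only, some capacity is left on
each resource of the item `i`. -/
def IsResidual (D : Set ι) (i : ι) : Prop :=
  i ∈ G.items ∧ ∀ x ∈ G.support i, G.used D x < G.cap x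

variable {G} {D D' : Set ι} {i j : ι} {x : ρ} {l : List ι}

@[simp] lemma mem_before : j ∈ G.before i ↔ G.key j < G.key i := Iff.rfl

@[simp] lemma mem_upto : j ∈ G.upto i ↔ G.key j ≤ G.key i := Iff.rfl

lemma mem_selected : i ∈ G.selected ↔ i ∈ G.items ∧ 0 < G.amount i := by
  simp [selected]

lemma amount_eq_sInf (i : ι) :
    G.amount i = sInf ((fun x => G.cap x - G.used (G.before i) x) '' G.support i) := by
  rw [amount]
  congr! 4 with x
  exact Finset.sum_attach _ G.amount

lemma isLeast_amount (hi : i ∈ G.items) :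
    IsLeast ((fun x => G.cap x - G.used (G.before i) x) '' G.support i) (G.amount i) := by
  rw [amount_eq_sInf]
  exact ⟨Nat.sInf_mem ((G.support_nonempty i hi).image _), fun _ hn => Nat.sInf_le hn⟩

lemma used_mono (h : ∀ i ∈ G.selected, x ∈ G.support i → i ∈ D → i ∈ D') :
    G.used D x ≤ G.used D' x := by
  classical
  refine Finset.sum_le_sum_of_ne_zero fun i hi hne => ?_
  rw [Finset.mem_filter] at hi ⊢
  have hsel := mem_selected.2 ⟨hi.1, Nat.pos_of_ne_zero hne⟩
  exact ⟨hi.1, h i hsel hi.2.2 hi.2.1, hi.2.2⟩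

lemma used_congr (h : ∀ i ∈ G.selected, x ∈ G.support i → (i ∈ D ↔ i ∈ D')) :
    G.used D x = G.used D' x :=
  le_antisymm (used_mono fun i hi hx => (h i hi hx).1) (used_mono fun i hi hx => (h i hi hx).2)

lemma used_upto (hi : i ∈ G.items) (hx : x ∈ G.support i) :
    G.used (G.upto i) x = G.used (G.before i) x + G.amount i := by
  classical
  rw [used, used, add_comm, ← Finset.sum_insert (by simp)]
  congr 1
  ext j
  simp only [Finset.mem_filter, Finset.mem_insert, mem_upto, mem_before, le_iff_lt_or_eq,
    G.key_injective.eq_iff]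
  grind

lemma exists_selected_used_le (h : 0 < G.used D x) :
    ∃ i ∈ G.selected, i ∈ D ∧ x ∈ G.support i ∧ G.used D x ≤ G.used (G.upto i) x := by
  classical
  obtain ⟨j, hj, hamount⟩ := Finset.exists_ne_zero_of_sum_ne_zero h.ne'
  rw [Finset.mem_filter] at hj
  obtain ⟨i, hi, hmax⟩ := Finset.exists_maximalFor G.key {i ∈ G.selected | i ∈ D ∧ x ∈ G.support i}
    ⟨j, Finset.mem_filter.2 ⟨mem_selected.2 ⟨hj.1, Nat.pos_of_ne_zero hamount⟩, hj.2⟩⟩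
  rw [Finset.mem_filter] at hi
  refine ⟨i, hi.1, hi.2.1, hi.2.2, used_mono fun k hk hxk hkD => ?_⟩
  exact (le_total (G.key k) (G.key i)).elim id (hmax (Finset.mem_filter.2 ⟨hk, hkD, hxk⟩))

lemma amount_le (hi : i ∈ G.items) (hx : x ∈ G.support i) :
    G.amount i ≤ G.cap x - G.used (G.before i) x :=
  (isLeast_amount hi).2 ⟨x, hx, rfl⟩

lemma exists_cap_le_used_upto (hi : i ∈ G.items) :
    ∃ x ∈ G.support i, G.cap x ≤ G.used (G.upto i) x := by
  obtain ⟨x, hx, hamount⟩ := (isLeast_amount hi).1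
  refine ⟨x, hx, ?_⟩
  rw [used_upto hi hx, ← hamount]
  exact le_add_tsub

lemma mem_selected_iff_isResidual (hi : i ∈ G.items) :
    i ∈ G.selected ↔ G.IsResidual (G.before i) i := by
  refine ⟨fun h => ⟨hi, fun x hx => ?_⟩, fun h => mem_selected.2 ⟨hi, ?_⟩⟩
  · have := (mem_selected.1 h).2
    have := amount_le hi hx
    omega
  · obtain ⟨x, hx, hamount⟩ := (isLeast_amount hi).1
    rw [← hamount]
    exact Nat.sub_pos_of_lt (h.2 x hx)

lemma IsResidual.anti (h : G.IsResidual D' i)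
    (hD : ∀ j ∈ G.selected, j ∈ D → j ∈ D') : G.IsResidual D i :=
  ⟨h.1, fun x hx => (used_mono fun j hj _ => hD j hj).trans_lt (h.2 x hx)⟩

lemma IsResidual.before_of_key_le (h : G.IsResidual (G.before i) j) {k : ι}
    (hk : G.key k ≤ G.key i) : G.IsResidual (G.before k) j :=
  h.anti fun _ _ hl => lt_of_lt_of_le hl hk

lemma isResidual_before_of_mem_selected (hi : i ∈ G.selected) : G.IsResidual (G.before i) i :=
  (mem_selected_iff_isResidual (mem_selected.1 hi).1).1 hi

lemma key_le_of_isResidual (h : G.IsResidual (G.before i) j) : G.key i ≤ G.key j := by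
  by_contra! hlt
  obtain ⟨x, hx, hfull⟩ := exists_cap_le_used_upto h.1
  exact (h.2 x hx).not_ge (hfull.trans (used_mono fun k _ _ hk => hk.trans_lt hlt))

lemma selected_nonempty (h : G.items.Nonempty) : G.selected.Nonempty := by
  obtain ⟨i, hi⟩ := h
  obtain ⟨x, hx, hfull⟩ := exists_cap_le_used_upto hi
  obtain ⟨j, hj, -⟩ := exists_selected_used_le ((G.cap_pos i hi x hx).trans_le hfull)
  exact ⟨j, hj⟩

lemma exists_key_le_isResidual (hi : i ∈ G.items) :
    ∃ j, G.key j ≤ G.key i ∧ G.IsResidual (G.before j) i ∧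
      ∃ x ∈ G.support i, G.cap x ≤ G.used (G.upto j) x := by
  classical
  obtain ⟨j, hj, hmin⟩ := Finset.exists_minimalFor G.key
    {j ∈ G.items | ∃ x ∈ G.support i, G.cap x ≤ G.used (G.upto j) x}
    ⟨i, Finset.mem_filter.2 ⟨hi, exists_cap_le_used_upto hi⟩⟩
  have hmin {k : ι} (hk : k ∈ G.items) {x : ρ} (hx : x ∈ G.support i)
      (hcap : G.cap x ≤ G.used (G.upto k) x) : G.key j ≤ G.key k := by
    refine (le_total (G.key k) (G.key j)).elim (hmin (Finset.mem_filter.2 ⟨hk, x, hx, hcap⟩)) id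
  refine ⟨j, ?_, ⟨hi, fun x hx => ?_⟩, (Finset.mem_filter.1 hj).2⟩
  · obtain ⟨x, hx, hcap⟩ := exists_cap_le_used_upto hi
    exact hmin hi hx hcap
  · by_contra! hcap
    obtain ⟨k, hk, hkj, -, hle⟩ := exists_selected_used_le ((G.cap_pos i hi x hx).trans_le hcap)
    exact (hmin (mem_selected.1 hk).1 hx (hcap.trans hle)).not_gt hkj

lemma used_eq_used_before (hnext : IsGreedyNext G.key G.selected l i) (x : ρ) :
    G.used {j | j ∈ l} x = G.used (G.before i) x :=
  used_congr fun j hj _ => hnext.mem_iff j hj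

lemma IsResidual.exists_selected_notMem (h : G.IsResidual D i) : ∃ j ∈ G.selected, j ∉ D := by
  obtain ⟨x, hx, hcap⟩ := exists_cap_le_used_upto h.1
  by_contra! hD
  exact (h.2 x hx).not_ge (hcap.trans (used_mono fun j hj _ _ => hD j hj))

lemma exists_isGreedyNext [WellFoundedLT κ] (hl : IsGreedyPrefix G.key G.selected l)
    (hj : G.IsResidual {i | i ∈ l} j) : ∃ i, IsGreedyNext G.key G.selected l i :=
  hl.exists_next hj.exists_selected_notMem

lemma isResidual_mem_iff (hnext : IsGreedyNext G.key G.selected l i) :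
    G.IsResidual {j | j ∈ l} j ↔ G.IsResidual (G.before i) j := by
  simp only [IsResidual, used_eq_used_before hnext]

lemma isGreedyNext_iff [WellFoundedLT κ] (hl : IsGreedyPrefix G.key G.selected l) :
    IsGreedyNext G.key G.selected l i ↔
      G.IsResidual {j | j ∈ l} i ∧ ∀ j, G.IsResidual {j | j ∈ l} j → G.key i ≤ G.key j := by
  refine ⟨fun h => ?_, fun ⟨hi, hmin⟩ => ?_⟩
  · simp only [isResidual_mem_iff h]
    exact ⟨isResidual_before_of_mem_selected h.mem, fun j => key_le_of_isResidual⟩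
  · obtain ⟨j, hj⟩ := exists_isGreedyNext hl hi
    have hij : G.key i = G.key j :=
      (hmin j ((isResidual_mem_iff hj).2 (isResidual_before_of_mem_selected hj.mem))).antisymm
        (key_le_of_isResidual ((isResidual_mem_iff hj).1 hi))
    exact G.key_injective hij ▸ hj

end PackingSystem

lemma eq_of_idxOf_eq {α : Type*} [DecidableEq α] {l l' : List α} (hl : l.Nodup)
    (hlength : l.length = l'.length) (hidx : ∀ a ∈ l, l'.idxOf a = l.idxOf a) : l = l' := by
  refine List.ext_getElem hlength fun i hi hi' => ?_
  have hidx_i : l'.idxOf l[i] = i := by rw [hidx _ (List.getElem_mem hi), hl.idxOf_getElem]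
  have := List.getElem_idxOf (hidx_i.trans_lt hi')
  simpa only [hidx_i] using this.symm

lemma mem_of_nodup_of_length_eq_card {α : Type*} [Fintype α] {l : List α} (hl : l.Nodup)
    (hlength : l.length = Fintype.card α) (a : α) : a ∈ l := by
  classical
  have huniv : l.toFinset = Finset.univ := by
    rw [← Finset.card_eq_iff_eq_univ, l.toFinset_card_of_nodup hl, hlength]
  exact List.mem_toFinset.1 (huniv ▸ Finset.mem_univ a)

namespace EvacNetwork

variable {V : Type*} {N : EvacNetwork V} {P Q W : List V} {u v : V}

section Walks

lemma pathEdges_cons_cons (u v : V) (l : List V) :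
    pathEdges (u :: v :: l) = (u, v) :: pathEdges (v :: l) := rfl

lemma pathEdges_append_cons (A : List V) (v : V) (B : List V) :
    pathEdges (A ++ v :: B) = pathEdges (A ++ [v]) ++ pathEdges (v :: B) := by
  induction A with
  | nil => rfl
  | cons u A ih =>
    cases A with
    | nil => rfl
    | cons w A => simpa only [List.cons_append, pathEdges_cons_cons, List.cons_inj_right] using ih

lemma exists_eq_append_of_mem_pathEdges {e : V × V} (he : e ∈ pathEdges P) :
    ∃ A B, P = A ++ e.1 :: e.2 :: B := by
  induction P with
  | nil => simp [pathEdges] at he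
  | cons u P ih =>
    cases P with
    | nil => simp [pathEdges] at he
    | cons v P =>
      rw [pathEdges_cons_cons, List.mem_cons] at he
      rcases he with rfl | he
      · exact ⟨[], P, rfl⟩
      · obtain ⟨A, B, hAB⟩ := ih he
        exact ⟨u :: A, B, by rw [hAB, List.cons_append]⟩

lemma fst_mem_of_mem_pathEdges {e : V × V} (he : e ∈ pathEdges P) : e.1 ∈ P :=
  (List.of_mem_zip (a := e.1) (b := e.2) he).1

@[simp] lemma pathTransit_singleton (v : V) : N.pathTransit [v] = 0 := rfl

lemma pathTransit_cons_cons (u v : V) (l : List V) :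
    N.pathTransit (u :: v :: l) = N.transit (u, v) + N.pathTransit (v :: l) := rfl

lemma pathTransit_append_cons (A : List V) (v : V) (B : List V) :
    N.pathTransit (A ++ v :: B) = N.pathTransit (A ++ [v]) + N.pathTransit (v :: B) := by
  simp [pathTransit, pathEdges_append_cons A v B]

lemma pathTransit_le (hP : ∀ e ∈ pathEdges P, e ∈ N.edgeSet) :
    N.pathTransit P ≤ (P.length - 1) * N.maxTransit := by
  have hle : ∀ d ∈ (pathEdges P).map N.transit, d ≤ N.maxTransit := by
    rintro _ hd
    obtain ⟨e, he, rfl⟩ := List.mem_map.1 hd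
    exact Finset.le_sup (hP e he)
  simpa [pathTransit, pathEdges] using List.sum_le_card_nsmul _ _ hle

lemma add_pathTransit_le {f : V → ℕ} (hf : ∀ e ∈ pathEdges P, f e.1 + N.transit e ≤ f e.2)
    (hu : P.head? = some u) (hv : P.getLast? = some v) : f u + N.pathTransit P ≤ f v := by
  induction P generalizing u with
  | nil => simp at hu
  | cons w P ih =>
    obtain rfl : w = u := by simpa using hu
    cases P with
    | nil =>
      obtain rfl : w = v := by simpa using hv
      rfl
    | cons x P =>
      rw [pathEdges_cons_cons, List.forall_mem_cons] at hf
      have := ih hf.2 rfl (by rwa [List.getLast?_cons_cons] at hv)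
      rw [pathTransit_cons_cons]
      linarith [hf.1]

end Walks

section Resources

/-- The nodes and the edges of the path, which are the resources whose capacity it needs. -/
def resources (P : List V) : Set (V ⊕ V × V) := {x | x.elim (· ∈ P) (· ∈ pathEdges P)}

/-- Capacity of a node or an edge. -/
def cap (N : EvacNetwork V) : V ⊕ V × V → ℕ := Sum.elim N.nodeCap N.edgeCap

/-- The node at which people begin to use a resource, which is its tail in the case of an edge. -/
def entry : V ⊕ V × V → V := Sum.elim id Prod.fst

@[simp] lemma inl_mem_resources : Sum.inl v ∈ resources P ↔ v ∈ P := Iff.rfl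

@[simp] lemma inr_mem_resources {e : V × V} : Sum.inr e ∈ resources P ↔ e ∈ pathEdges P := Iff.rfl

lemma resources_append_cons (A : List V) (v : V) (B : List V) :
    resources (A ++ v :: B) = resources (A ++ [v]) ∪ resources (v :: B) := by
  ext (u | e)
  · simp [or_assoc]
  · simp [pathEdges_append_cons A v B]

lemma resources_cons_cons (u v : V) (l : List V) :
    resources (u :: v :: l) = {.inl u, .inr (u, v)} ∪ resources (v :: l) := by
  ext (w | e) <;> simp [pathEdges_cons_cons]

lemma entry_mem {x : V ⊕ V × V} (hx : x ∈ resources P) : entry x ∈ P := by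
  cases x with
  | inl v => exact hx
  | inr e => exact fst_mem_of_mem_pathEdges hx

lemma exists_nodup_resources_subset (W : List V) :
    ∃ P : List V, P.head? = W.head? ∧ P.getLast? = W.getLast? ∧ P.Nodup ∧
      resources P ⊆ resources W ∧ N.pathTransit P ≤ N.pathTransit W := by
  induction W with
  | nil => exact ⟨[], by simp⟩
  | cons u W ih =>
    cases W with
    | nil => exact ⟨[u], by simp⟩
    | cons w W =>
      obtain ⟨P, hhead, hlast, hnodup, hres, htransit⟩ := ih
      rw [resources_cons_cons, pathTransit_cons_cons, List.getLast?_cons_cons, ← hlast]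
      by_cases hu : u ∈ P
      · obtain ⟨A, B, rfl⟩ := List.append_of_mem hu
        rw [resources_append_cons, Set.union_subset_iff] at hres
        rw [pathTransit_append_cons] at htransit
        exact ⟨u :: B, rfl, (List.getLast?_append_cons A u B).symm,
          (List.nodup_append.1 hnodup).2.1,
          hres.2.trans Set.subset_union_right, by omega⟩
      · cases P with
        | nil => simp at hhead
        | cons x P =>
          obtain rfl : x = w := by simpa using hhead
          refine ⟨u :: x :: P, rfl, List.getLast?_cons_cons, List.nodup_cons.2 ⟨hu, hnodup⟩, ?_, ?_⟩
          · rw [resources_cons_cons]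
            exact Set.union_subset_union_right _ hres
          · rw [pathTransit_cons_cons]
            exact Nat.add_le_add_left htransit _

end Resources

section PrefixSuffix

variable [DecidableEq V]

/-- Transit time of the part of `P` that ends at its node `v`. -/
def prefixTransit (N : EvacNetwork V) (P : List V) (v : V) : ℕ :=
  N.pathTransit (P.take (P.idxOf v + 1))

/-- Transit time of the part of `P` that starts at its node `v`. -/
def suffixTransit (N : EvacNetwork V) (P : List V) (v : V) : ℕ :=
  N.pathTransit (P.drop (P.idxOf v))

lemma prefixTransit_append_cons {A : List V} (hv : v ∉ A) (B : List V) :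
    N.prefixTransit (A ++ v :: B) v = N.pathTransit (A ++ [v]) := by
  simp [prefixTransit, List.idxOf_append_of_notMem hv, List.take_append, List.take_of_length_le]

lemma suffixTransit_append_cons {A : List V} (hv : v ∉ A) (B : List V) :
    N.suffixTransit (A ++ v :: B) v = N.pathTransit (v :: B) := by
  simp [suffixTransit, List.idxOf_append_of_notMem hv]

lemma prefixTransit_add_suffixTransit (hv : v ∈ P) :
    N.prefixTransit P v + N.suffixTransit P v = N.pathTransit P := by
  obtain ⟨A, B, rfl, hA⟩ := List.eq_append_cons_of_mem hv
  rw [prefixTransit_append_cons hA, suffixTransit_append_cons hA, ← pathTransit_append_cons]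

lemma suffixTransit_fst (hP : P.Nodup) {e : V × V} (he : e ∈ pathEdges P) :
    N.suffixTransit P e.1 = N.transit e + N.suffixTransit P e.2 := by
  obtain ⟨A, B, rfl⟩ := exists_eq_append_of_mem_pathEdges he
  have hfst : e.1 ∉ A := by grind
  have hsnd : e.2 ∉ A ++ [e.1] := by grind
  rw [suffixTransit_append_cons hfst, pathTransit_cons_cons, ← suffixTransit_append_cons hsnd,
    List.append_assoc, List.singleton_append]

lemma prefixTransit_le (hP : ∀ e ∈ pathEdges P, e ∈ N.edgeSet) (hv : v ∈ P) :
    N.prefixTransit P v ≤ P.idxOf v * N.maxTransit := by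
  obtain ⟨A, B, rfl, hA⟩ := List.eq_append_cons_of_mem hv
  rw [pathEdges_append_cons] at hP
  rw [prefixTransit_append_cons hA]
  simpa [List.idxOf_append_of_notMem hA] using
    pathTransit_le fun e he => hP e (List.mem_append_left _ he)

lemma suffixTransit_le (hP : ∀ e ∈ pathEdges P, e ∈ N.edgeSet) (hv : v ∈ P) :
    N.suffixTransit P v ≤ (P.length - 1 - P.idxOf v) * N.maxTransit := by
  obtain ⟨A, B, rfl, hA⟩ := List.eq_append_cons_of_mem hv
  rw [pathEdges_append_cons] at hP
  rw [suffixTransit_append_cons hA]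
  simpa [List.idxOf_append_of_notMem hA] using
    pathTransit_le fun e he => hP e (List.mem_append_right _ he)

end PrefixSuffix

section Paths

lemma IsPath.nodup (hP : N.IsPath P) : P.Nodup := hP.2.2.1

lemma IsPath.mem_edgeSet (hP : N.IsPath P) : ∀ e ∈ pathEdges P, e ∈ N.edgeSet := hP.2.2.2

lemma IsPath.source_mem (hP : N.IsPath P) : N.source ∈ P := List.mem_of_head? hP.1

lemma IsPath.suffixTransit_source [DecidableEq V] (hP : N.IsPath P) :
    N.suffixTransit P N.source = N.pathTransit P := by
  obtain ⟨l, rfl⟩ := List.head?_eq_some_iff.1 hP.1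
  exact suffixTransit_append_cons List.not_mem_nil l

lemma IsPath.suffixTransit_sink [DecidableEq V] (hP : N.IsPath P) :
    N.suffixTransit P N.sink = 0 := by
  obtain ⟨l, rfl⟩ := List.getLast?_eq_some_iff.1 hP.2.1
  have hl : N.sink ∉ l := by grind [hP.nodup]
  rw [suffixTransit_append_cons hl, pathTransit_singleton]

lemma IsPath.cap_pos (hP : N.IsPath P) {x : V ⊕ V × V} (hx : x ∈ resources P) : 0 < N.cap x := by
  cases x with
  | inl v => exact N.nodeCap_pos v
  | inr e => exact N.edgeCap_pos e (hP.mem_edgeSet e hx)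

lemma IsPath.pathTransit_le [Fintype V] (hP : N.IsPath P) :
    N.pathTransit P ≤ (Fintype.card V - 1) * N.maxTransit :=
  (EvacNetwork.pathTransit_le hP.mem_edgeSet).trans
    (Nat.mul_le_mul_right _ (Nat.sub_le_sub_right hP.nodup.length_le_card 1))

lemma IsPath.length_eq_card [Fintype V] (hP : N.IsPath P) (hτ : 0 < N.maxTransit)
    (hmax : (Fintype.card V - 1) * N.maxTransit ≤ N.pathTransit P) :
    P.length = Fintype.card V := by
  have hle := Nat.le_of_mul_le_mul_right
    (hmax.trans (EvacNetwork.pathTransit_le hP.mem_edgeSet)) hτ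
  have hlength := hP.nodup.length_le_card
  have hpos := List.length_pos_of_mem hP.source_mem
  omega

lemma IsPath.prefixTransit_eq [Fintype V] [DecidableEq V] (hP : N.IsPath P)
    (hmax : (Fintype.card V - 1) * N.maxTransit ≤ N.pathTransit P) (hv : v ∈ P) :
    N.prefixTransit P v = P.idxOf v * N.maxTransit := by
  refine (prefixTransit_le hP.mem_edgeSet hv).antisymm ?_
  have hsum := prefixTransit_add_suffixTransit (N := N) hv
  have hsuffix := suffixTransit_le hP.mem_edgeSet hv
  have hidx : P.idxOf v < P.length := List.idxOf_lt_length_of_mem hv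
  have hlength := hP.nodup.length_le_card
  have : P.idxOf v * N.maxTransit + (P.length - 1 - P.idxOf v) * N.maxTransit ≤
      (Fintype.card V - 1) * N.maxTransit := by
    rw [← add_mul]
    exact Nat.mul_le_mul_right _ (by omega)
  omega

lemma finite_isPath [Finite V] (N : EvacNetwork V) : {P | N.IsPath P}.Finite := by
  have := Fintype.ofFinite V
  exact (List.finite_length_le V (Fintype.card V)).subset fun P hP => hP.nodup.length_le_card

end Paths

end EvacNetwork

namespace EvacNetwork

variable {V : Type*} {N : EvacNetwork V} {rank : List V → ℕ} {P Q W : List V} {v : V}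

lemma pathKey_injective (N : EvacNetwork V) (hrank : Function.Injective rank) :
    Function.Injective (N.pathKey rank) := fun _ _ h =>
  hrank (Prod.ext_iff.1 (toLex.injective h)).2

lemma pathTransit_le_of_pathKey_le (h : N.pathKey rank P ≤ N.pathKey rank Q) :
    N.pathTransit P ≤ N.pathTransit Q :=
  Prod.Lex.monotone_fst _ _ h

section PathSystem

variable [Finite V]

/-- The paths of the network, in the order in which both algorithms consider them, compete for the
capacities of the nodes and edges. -/
noncomputable def pathSystem (N : EvacNetwork V) (hrank : Function.Injective rank) :
    PackingSystem (List V) (V ⊕ V × V) (ℕ ×ₗ ℕ) where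
  items := N.finite_isPath.toFinset
  key := N.pathKey rank
  key_injective := N.pathKey_injective hrank
  support := resources
  support_nonempty _ hP := ⟨.inl N.source, ((Set.Finite.mem_toFinset _).1 hP).source_mem⟩
  cap := N.cap
  cap_pos _ hP _ := ((Set.Finite.mem_toFinset _).1 hP).cap_pos

variable {hrank : Function.Injective rank}

@[simp] lemma mem_items_pathSystem : P ∈ (N.pathSystem hrank).items ↔ N.IsPath P :=
  Set.Finite.mem_toFinset _

lemma isPath_of_mem_selected (hP : P ∈ (N.pathSystem hrank).selected) : N.IsPath P :=
  mem_items_pathSystem.1 (PackingSystem.mem_selected.1 hP).1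

end PathSystem

section Exchange

variable [Finite V] {hrank : Function.Injective rank} {D : Set (List V)}

lemma exists_isResidual_of_walk (hsource : W.head? = some N.source)
    (hsink : W.getLast? = some N.sink) (hedge : ∀ e ∈ pathEdges W, e ∈ N.edgeSet)
    (hres : ∀ x ∈ resources W, (N.pathSystem hrank).used D x < N.cap x) :
    ∃ X, (N.pathSystem hrank).IsResidual D X ∧ N.pathTransit X ≤ N.pathTransit W := by
  obtain ⟨X, hhead, hlast, hnodup, hsub, hle⟩ := exists_nodup_resources_subset (N := N) W
  have hX : N.IsPath X :=
    ⟨hhead.trans hsource, hlast.trans hsink, hnodup, fun e he => hedge e (hsub (a := .inr e) he)⟩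
  exact ⟨X, ⟨mem_items_pathSystem.2 hX, fun x hx => hres x (hsub hx)⟩, hle⟩

variable [DecidableEq V]

lemma exists_isResidual_splice (hP : (N.pathSystem hrank).IsResidual D P)
    (hQ : (N.pathSystem hrank).IsResidual D Q) (hvP : v ∈ P) (hvQ : v ∈ Q) :
    ∃ X, (N.pathSystem hrank).IsResidual D X ∧
      N.pathTransit X ≤ N.prefixTransit P v + N.suffixTransit Q v := by
  obtain ⟨A, B, rfl, hA⟩ := List.eq_append_cons_of_mem hvP
  obtain ⟨A', B', rfl, hA'⟩ := List.eq_append_cons_of_mem hvQ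
  rw [prefixTransit_append_cons hA, suffixTransit_append_cons hA', ← pathTransit_append_cons]
  have hPpath := mem_items_pathSystem.1 hP.1
  have hQpath := mem_items_pathSystem.1 hQ.1
  have hres : resources (A ++ v :: B') ⊆ resources (A ++ v :: B) ∪ resources (A' ++ v :: B') := by
    rw [resources_append_cons A v B, resources_append_cons A v B', resources_append_cons A' v B']
    exact Set.union_subset_union Set.subset_union_left Set.subset_union_right
  refine exists_isResidual_of_walk ?_ ?_ (fun e he => ?_) fun x hx => ?_
  · have := hPpath.1
    cases A <;> simpa using this
  · rw [List.getLast?_append_cons, ← hQpath.2.1, List.getLast?_append_cons]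
  · exact (hres (a := .inr e) he).elim (hPpath.mem_edgeSet e) (hQpath.mem_edgeSet e)
  · exact (hres hx).elim (hP.2 x) (hQ.2 x)

variable (hP : (N.pathSystem hrank).IsResidual ((N.pathSystem hrank).before Q) P)
  (hQ : Q ∈ (N.pathSystem hrank).selected) (hvP : v ∈ P) (hvQ : v ∈ Q)

include hP hQ hvP hvQ

lemma prefixTransit_le_of_isResidual : N.prefixTransit Q v ≤ N.prefixTransit P v := by
  obtain ⟨X, hX, hle⟩ := exists_isResidual_splice hP
    (PackingSystem.isResidual_before_of_mem_selected hQ) hvP hvQ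
  have hQX : N.pathTransit Q ≤ N.pathTransit X :=
    pathTransit_le_of_pathKey_le (PackingSystem.key_le_of_isResidual hX)
  have := prefixTransit_add_suffixTransit (N := N) hvQ
  omega

lemma suffixTransit_le_of_isResidual : N.suffixTransit Q v ≤ N.suffixTransit P v := by
  obtain ⟨X, hX, hle⟩ := exists_isResidual_splice
    (PackingSystem.isResidual_before_of_mem_selected hQ) hP hvQ hvP
  have hQX : N.pathTransit Q ≤ N.pathTransit X :=
    pathTransit_le_of_pathKey_le (PackingSystem.key_le_of_isResidual hX)
  have := prefixTransit_add_suffixTransit (N := N) hvQ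
  omega

end Exchange

section ExtremalPaths

variable [Fintype V] {hrank : Function.Injective rank}

lemma pathTransit_lt_of_pathKey_lt (hτ : 0 < N.maxTransit)
    (hQ : Q ∈ (N.pathSystem hrank).selected) (hP : P ∈ (N.pathSystem hrank).selected)
    (hlt : N.pathKey rank Q < N.pathKey rank P) :
    N.pathTransit Q < (Fintype.card V - 1) * N.maxTransit := by
  classical
  by_contra! hQmax
  have hPmax := hQmax.trans (pathTransit_le_of_pathKey_le hlt.le)
  have hQpath := isPath_of_mem_selected hQ
  have hPpath := isPath_of_mem_selected hP
  have hQlength := hQpath.length_eq_card hτ hQmax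
  have hPlength := hPpath.length_eq_card hτ hPmax
  have hPres : (N.pathSystem hrank).IsResidual ((N.pathSystem hrank).before Q) P :=
    (PackingSystem.isResidual_before_of_mem_selected hP).before_of_key_le hlt.le
  have hidx : ∀ v ∈ Q, P.idxOf v = Q.idxOf v := fun v hv => by
    have hvP := mem_of_nodup_of_length_eq_card hPpath.nodup hPlength v
    have hprefix := prefixTransit_le_of_isResidual hPres hQ hvP hv
    have hsuffix := suffixTransit_le_of_isResidual hPres hQ hvP hv
    have hQsum := prefixTransit_add_suffixTransit (N := N) hv
    have hPsum := prefixTransit_add_suffixTransit (N := N) hvP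
    have hPle := hPpath.pathTransit_le
    refine Nat.eq_of_mul_eq_mul_right hτ ?_
    rw [← hPpath.prefixTransit_eq hPmax hvP, ← hQpath.prefixTransit_eq hQmax hv]
    omega
  exact hlt.ne (congrArg _ (eq_of_idxOf_eq hQpath.nodup (hQlength.trans hPlength.symm) hidx))

lemma sum_pathTransit_add_card_le (hτ : 0 < N.maxTransit) {U : Finset (List V)}
    (hU : U ⊆ (N.pathSystem hrank).selected) :
    ∑ Q ∈ U, N.pathTransit Q + U.card ≤ U.card * ((Fintype.card V - 1) * N.maxTransit) + 1 := by
  classical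
  rcases U.eq_empty_or_nonempty with rfl | hne
  · simp
  obtain ⟨P, hP, hlast⟩ := Finset.exists_max_image U (N.pathKey rank) hne
  have hothers : ∑ Q ∈ U.erase P, (N.pathTransit Q + 1) ≤
      (U.erase P).card • ((Fintype.card V - 1) * N.maxTransit) := by
    refine Finset.sum_le_card_nsmul _ _ _ fun Q hQ => ?_
    rw [Finset.mem_erase] at hQ
    refine pathTransit_lt_of_pathKey_lt hτ (hU hQ.2) (hU hP) ((hlast Q hQ.2).lt_of_ne fun h => ?_)
    exact hQ.1 (N.pathKey_injective hrank h)
  rw [Finset.sum_add_distrib, Finset.sum_const, smul_eq_mul, smul_eq_mul, mul_one] at hothers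
  have hPle := (isPath_of_mem_selected (hU hP)).pathTransit_le
  rw [← Finset.add_sum_erase U N.pathTransit hP, ← Finset.card_erase_add_one hP, add_mul, one_mul]
  omega

end ExtremalPaths

end EvacNetwork

namespace EvacNetwork

variable {V : Type*} {N : EvacNetwork V} {P : List V} {r : EvacRoute V} {v : V} {x : V ⊕ V × V}
  {a z : ℕ}

section Routes

/-- The route needs the capacity of the resource `x` at time `z`. -/
def Uses (r : EvacRoute V) (x : V ⊕ V × V) (z : ℕ) : Prop :=
  x.elim (r.UsesNode · z) (r.UsesEdge · z)

lemma IsRoute.isPath (h : N.IsRoute r) : N.IsPath r.path := h.1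

lemma IsRoute.arr_le_dep (h : N.IsRoute r) (hv : v ∈ r.path) : r.arr v ≤ r.dep v := h.2.1 v hv

lemma IsRoute.uses_dep (h : N.IsRoute r) (hx : x ∈ resources r.path) :
    Uses r x (r.dep (entry x)) := by
  cases x with
  | inl v => exact ⟨hx, h.arr_le_dep hx, le_rfl⟩
  | inr e => exact ⟨hx, rfl⟩

variable [DecidableEq V]

lemma IsRoute.dep_source_add_prefixTransit_le (h : N.IsRoute r) (hv : v ∈ r.path) :
    r.dep N.source + N.prefixTransit r.path v ≤ r.arr v := by
  obtain ⟨hpath, hwait, hmove, hsource, -⟩ := h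
  obtain ⟨A, B, hAB, hA⟩ := List.eq_append_cons_of_mem hv
  have hhead := hpath.1
  rw [hAB] at hwait hmove hhead ⊢
  rw [pathEdges_append_cons] at hmove
  rw [prefixTransit_append_cons hA, ← hsource]
  refine add_pathTransit_le (fun e he => ?_) (by cases A <;> simpa using hhead) (by simp)
  have hfst : e.1 ∈ A ++ v :: B := by
    have := fst_mem_of_mem_pathEdges he
    grind
  rw [hmove e (List.mem_append_left _ he)]
  exact Nat.add_le_add_right (hwait _ hfst) _

lemma IsRoute.dep_add_suffixTransit_le (h : N.IsRoute r) (hv : v ∈ r.path) :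
    r.dep v + N.suffixTransit r.path v ≤ r.arr N.sink := by
  obtain ⟨hpath, hwait, hmove, -, hsink⟩ := h
  obtain ⟨A, B, hAB, hA⟩ := List.eq_append_cons_of_mem hv
  have hlast := hpath.2.1
  rw [hAB] at hwait hmove hlast ⊢
  rw [pathEdges_append_cons] at hmove
  rw [suffixTransit_append_cons hA, hsink]
  refine add_pathTransit_le (fun e he => ?_) rfl (by rwa [List.getLast?_append_cons] at hlast)
  have hsnd : e.2 ∈ A ++ v :: B :=
    List.mem_append_right _ (List.mem_of_mem_tail (List.of_mem_zip (a := e.1) he).2)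
  rw [← hmove e (List.mem_append_right _ he)]
  exact hwait _ hsnd

lemma IsRoute.dep_add_suffixTransit_eq (h : N.IsRoute r) (hdelay : N.delay r = 0)
    (hv : v ∈ r.path) : r.dep v + N.suffixTransit r.path v = r.arr N.sink := by
  have hprefix := h.dep_source_add_prefixTransit_le hv
  have hsuffix := h.dep_add_suffixTransit_le hv
  have hsum := prefixTransit_add_suffixTransit (N := N) hv
  have hwait := h.arr_le_dep hv
  unfold delay at hdelay
  omega

omit [DecidableEq V] in
lemma IsRoute.arr_eq_dep (h : N.IsRoute r) (hdelay : N.delay r = 0) (hv : v ∈ r.path) :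
    r.arr v = r.dep v := by
  classical
  have hprefix := h.dep_source_add_prefixTransit_le hv
  have hsuffix := h.dep_add_suffixTransit_le hv
  have hsum := prefixTransit_add_suffixTransit (N := N) hv
  have hwait := h.arr_le_dep hv
  unfold delay at hdelay
  omega

lemma IsRoute.uses_iff (h : N.IsRoute r) (hdelay : N.delay r = 0) :
    Uses r x z ↔ x ∈ resources r.path ∧ r.arr N.sink = z + N.suffixTransit r.path (entry x) := by
  have hdep {v : V} (hv : v ∈ r.path) :
      r.arr N.sink = z + N.suffixTransit r.path v ↔ z = r.dep v := by
    have := h.dep_add_suffixTransit_eq hdelay hv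
    omega
  cases x with
  | inl v =>
    refine and_congr_right fun hv => ?_
    rw [h.arr_eq_dep hdelay hv, ← le_antisymm_iff, eq_comm]
    exact (hdep hv).symm
  | inr e => exact and_congr_right fun he => (hdep (fst_mem_of_mem_pathEdges he)).symm

/-- The route along `P` without any waiting that arrives at time `a`. -/
def directRoute (N : EvacNetwork V) (P : List V) (a : ℕ) : EvacRoute V where
  path := P
  arr v := a - N.suffixTransit P v
  dep v := a - N.suffixTransit P v

lemma directRoute_arr_sink (hP : N.IsPath P) (a : ℕ) : (N.directRoute P a).arr N.sink = a := by
  simp [directRoute, hP.suffixTransit_sink]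

lemma isRoute_directRoute (hP : N.IsPath P) (ha : N.pathTransit P ≤ a) :
    N.IsRoute (N.directRoute P a) := by
  refine ⟨hP, fun v _ => le_rfl, fun e (he : e ∈ pathEdges P) => ?_, rfl, rfl⟩
  have hfst := suffixTransit_fst (N := N) hP.nodup he
  have hle := prefixTransit_add_suffixTransit (N := N) (fst_mem_of_mem_pathEdges he)
  change a - N.suffixTransit P e.2 = a - N.suffixTransit P e.1 + N.transit e
  omega

lemma delay_directRoute (hP : N.IsPath P) (ha : N.pathTransit P ≤ a) :
    N.delay (N.directRoute P a) = 0 := by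
  rw [delay, directRoute_arr_sink hP]
  change a - (a - N.suffixTransit P N.source) - N.pathTransit P = 0
  rw [hP.suffixTransit_source]
  omega

end Routes

section Reservations

open Classical in
/-- The capacity of the resource `x` at time `z` that the groups in `R` have reserved. -/
noncomputable def reserved (R : List (EvacRoute V × ℕ)) (x : V ⊕ V × V) (z : ℕ) : ℕ :=
  (R.map fun g => if Uses g.1 x z then g.2 else 0).sum

lemma mem_availAlong {R : List (EvacRoute V × ℕ)} {c : ℕ} :
    c ∈ N.availAlong R r ↔ ∃ x z, Uses r x z ∧ c = N.cap x - reserved R x z := by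
  constructor
  · rintro (⟨v, z, h, rfl⟩ | ⟨e, z, h, rfl⟩)
    · exact ⟨.inl v, z, h, rfl⟩
    · exact ⟨.inr e, z, h, rfl⟩
  · rintro ⟨v | e, z, h, rfl⟩
    · exact .inl ⟨v, z, h, rfl⟩
    · exact .inr ⟨e, z, h, rfl⟩

end Reservations

end EvacNetwork

namespace EvacNetwork

variable {V : Type*} {N : EvacNetwork V} {rank : List V → ℕ} {P Q : List V} {v : V}
  {r r' : EvacRoute V} {κ κ' : ℕ × List V} {z : ℕ}

section Slots

/-- The slot of a route: its arrival time at the sink and its path. -/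
def slot (N : EvacNetwork V) (r : EvacRoute V) : ℕ × List V := (r.arr N.sink, r.path)

/-- The order in which CCRP fills the slots. -/
def slotKey (N : EvacNetwork V) (rank : List V → ℕ) (κ : ℕ × List V) : ℕ ×ₗ ℕ ×ₗ ℕ :=
  toLex (κ.1, N.pathKey rank κ.2)

lemma slotKey_injective (N : EvacNetwork V) (hrank : Function.Injective rank) :
    Function.Injective (N.slotKey rank) := fun _ _ h =>
  have h := Prod.ext_iff.1 (toLex.injective h)
  Prod.ext h.1 (N.pathKey_injective hrank h.2)

lemma slotKey_le_slotKey (hfst : κ.1 ≤ κ'.1)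
    (hsnd : N.pathKey rank κ.2 ≤ N.pathKey rank κ'.2) : N.slotKey rank κ ≤ N.slotKey rank κ' :=
  Prod.Lex.toLex_mono ⟨hfst, hsnd⟩

lemma fst_le_of_slotKey_le (h : N.slotKey rank κ ≤ N.slotKey rank κ') : κ.1 ≤ κ'.1 :=
  Prod.Lex.monotone_fst (toLex (κ.1, N.pathKey rank κ.2)) _ h

lemma slotKey_lt_or_eq_of_routeKey_le (h : N.routeKey rank r ≤ N.routeKey rank r') :
    N.slotKey rank (N.slot r) < N.slotKey rank (N.slot r') ∨
      N.slotKey rank (N.slot r) = N.slotKey rank (N.slot r') ∧ N.delay r ≤ N.delay r' := by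
  simp only [routeKey, Prod.Lex.toLex_le_toLex] at h
  simp only [slotKey, pathKey, slot, Prod.Lex.toLex_lt_toLex, toLex_inj, Prod.mk.injEq]
  tauto

variable [Finite V]

/-- The slots in which the greedy packing of the paths lets people arrive at the sink: those of the
routes along a selected path, which start at some time `≥ 0`. -/
def slots (N : EvacNetwork V) (hrank : Function.Injective rank) : Set (ℕ × List V) :=
  {κ | κ.2 ∈ (N.pathSystem hrank).selected ∧ N.pathTransit κ.2 ≤ κ.1}

variable {hrank : Function.Injective rank}

lemma slots_infinite (hP : N.IsPath P) : (N.slots hrank).Infinite := by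
  obtain ⟨Q, hQ⟩ := PackingSystem.selected_nonempty ⟨P, mem_items_pathSystem (hrank := hrank).2 hP⟩
  refine Set.infinite_of_injective_forall_mem (f := fun m => (N.pathTransit Q + m, Q))
    (fun m m' h => ?_) fun m => ⟨hQ, Nat.le_add_right _ _⟩
  simpa using h

variable [DecidableEq V]

lemma add_suffixTransit_mem_slots_iff (hQ : Q ∈ (N.pathSystem hrank).selected) (hv : v ∈ Q) :
    (z + N.suffixTransit Q v, Q) ∈ N.slots hrank ↔ N.prefixTransit Q v ≤ z := by
  have hsum := prefixTransit_add_suffixTransit (N := N) hv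
  refine (and_iff_right hQ).trans ?_
  change N.pathTransit Q ≤ z + N.suffixTransit Q v ↔ _
  omega

lemma slotKey_add_suffixTransit_le
    (hP : (N.pathSystem hrank).IsResidual ((N.pathSystem hrank).before Q) P)
    (hQ : Q ∈ (N.pathSystem hrank).selected) (hvP : v ∈ P) (hvQ : v ∈ Q) :
    N.slotKey rank (z + N.suffixTransit Q v, Q) ≤ N.slotKey rank (z + N.suffixTransit P v, P) :=
  slotKey_le_slotKey (Nat.add_le_add_left (suffixTransit_le_of_isResidual hP hQ hvP hvQ) z)
    (PackingSystem.key_le_of_isResidual hP)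

lemma slotKey_add_suffixTransit_lt_iff (hP : P ∈ (N.pathSystem hrank).selected)
    (hQ : Q ∈ (N.pathSystem hrank).selected) (hvP : v ∈ P) (hvQ : v ∈ Q) :
    N.slotKey rank (z + N.suffixTransit Q v, Q) < N.slotKey rank (z + N.suffixTransit P v, P) ↔
      N.pathKey rank Q < N.pathKey rank P := by
  have hP' := PackingSystem.isResidual_before_of_mem_selected hP
  have hQ' := PackingSystem.isResidual_before_of_mem_selected hQ
  refine ⟨fun hlt => ?_, fun hlt => ?_⟩
  · by_contra! hle
    exact hlt.not_ge
      (slotKey_add_suffixTransit_le (hQ'.before_of_key_le hle) hP hvQ hvP)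
  · refine (slotKey_add_suffixTransit_le (hP'.before_of_key_le hlt.le) hQ hvP
      hvQ).lt_of_ne fun heq => hlt.ne ?_
    exact congrArg _ (Prod.ext_iff.1 (N.slotKey_injective hrank heq)).2

end Slots

section Reservations

variable [Finite V] {hrank : Function.Injective rank} {R : List (EvacRoute V × ℕ)}
  {x : V ⊕ V × V}

/-- The groups in `R` travel without delay, fill their slots with the amounts which the greedy
packing provides for their paths, and these slots are the first ones. -/
structure FillsSlots (N : EvacNetwork V) (hrank : Function.Injective rank)
    (R : List (EvacRoute V × ℕ)) : Prop where
  isRoute : ∀ g ∈ R, N.IsRoute g.1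
  delay_eq_zero : ∀ g ∈ R, N.delay g.1 = 0
  size_eq : ∀ g ∈ R, g.2 = (N.pathSystem hrank).amount g.1.path
  isGreedyPrefix :
    IsGreedyPrefix (N.slotKey rank) (N.slots hrank) (R.map fun g => N.slot g.1)

lemma FillsSlots.sum_map [DecidableEq V] (h : N.FillsSlots hrank R) (f : ℕ × List V → ℕ) :
    (R.map fun g => f (N.slot g.1)).sum = ∑ κ ∈ (R.map fun g => N.slot g.1).toFinset, f κ := by
  rw [List.sum_toFinset _ h.isGreedyPrefix.nodup, List.map_map]
  rfl

lemma FillsSlots.evacuated_eq [DecidableEq V] (h : N.FillsSlots hrank R) :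
    evacuated R =
      ∑ κ ∈ (R.map fun g => N.slot g.1).toFinset, (N.pathSystem hrank).amount κ.2 := by
  rw [← h.sum_map, evacuated]
  exact congrArg List.sum (List.map_congr_left h.size_eq)

lemma FillsSlots.reserved_eq [DecidableEq V] (h : N.FillsSlots hrank R) (x : V ⊕ V × V) (z : ℕ) :
    reserved R x z = (N.pathSystem hrank).used
      {Q | (z + N.suffixTransit Q (entry x), Q) ∈ R.map fun g => N.slot g.1} x := by
  classical
  have hsum : reserved R x z = (R.map fun g =>
      if x ∈ resources (N.slot g.1).2 ∧
          (N.slot g.1).1 = z + N.suffixTransit (N.slot g.1).2 (entry x)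
        then (N.pathSystem hrank).amount (N.slot g.1).2 else 0).sum := by
    refine congrArg List.sum (List.map_congr_left fun g hg => ?_)
    rw [h.size_eq g hg]
    exact if_congr ((h.isRoute g hg).uses_iff (h.delay_eq_zero g hg)) rfl rfl
  rw [hsum, h.sum_map fun κ => if x ∈ resources κ.2 ∧ κ.1 = z + N.suffixTransit κ.2 (entry x)
    then (N.pathSystem hrank).amount κ.2 else 0, ← Finset.sum_filter, PackingSystem.used]
  refine Finset.sum_nbij' Prod.snd (fun Q => (z + N.suffixTransit Q (entry x), Q)) ?_ ?_ ?_
    (fun _ _ => rfl) fun _ _ => rfl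
  · rintro ⟨b, Q⟩ hκ
    simp only [Finset.mem_filter, List.mem_toFinset] at hκ ⊢
    obtain ⟨hmem, hx, rfl⟩ := hκ
    exact ⟨(PackingSystem.mem_selected.1 (h.isGreedyPrefix.subset _ hmem).1).1, hmem, hx⟩
  · intro Q hQ
    simp only [Finset.mem_filter, List.mem_toFinset] at hQ ⊢
    exact ⟨hQ.2.1, hQ.2.2, trivial⟩
  · rintro κ hκ
    exact Prod.ext (Finset.mem_filter.1 hκ).2.2.symm rfl

lemma FillsSlots.reserved_eq_used_before [DecidableEq V] (h : N.FillsSlots hrank R)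
    (hnext : IsGreedyNext (N.slotKey rank) (N.slots hrank) (R.map fun g => N.slot g.1)
      (z + N.suffixTransit P (entry x), P)) (hx : x ∈ resources P) :
    reserved R x z = (N.pathSystem hrank).used ((N.pathSystem hrank).before P) x := by
  rw [h.reserved_eq]
  refine PackingSystem.used_congr fun Q hQ hxQ => ?_
  have hP : P ∈ (N.pathSystem hrank).selected := hnext.mem.1
  have hiff := slotKey_add_suffixTransit_lt_iff (z := z) hP hQ (entry_mem hx) (entry_mem hxQ)
  refine ⟨fun hmem => hiff.1 ((hnext.mem_iff _ (h.isGreedyPrefix.subset _ hmem)).1 hmem),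
    fun hlt => ?_⟩
  refine (hnext.mem_iff _ ((add_suffixTransit_mem_slots_iff hQ (entry_mem hxQ)).2 ?_)).2
    (hiff.2 hlt)
  have hPres := (PackingSystem.isResidual_before_of_mem_selected hP).before_of_key_le hlt.le
  exact (prefixTransit_le_of_isResidual hPres hQ (entry_mem hx) (entry_mem hxQ)).trans
    ((add_suffixTransit_mem_slots_iff hP (entry_mem hx)).1 hnext.mem)

lemma FillsSlots.isLeast_availAlong (h : N.FillsSlots hrank R) (hr : N.IsRoute r)
    (hdelay : N.delay r = 0)
    (hnext : IsGreedyNext (N.slotKey rank) (N.slots hrank) (R.map fun g => N.slot g.1)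
      (N.slot r)) :
    IsLeast (N.availAlong R r) ((N.pathSystem hrank).amount r.path) := by
  classical
  have hreserved {x : V ⊕ V × V} {z : ℕ} (hx : Uses r x z) :
      reserved R x z = (N.pathSystem hrank).used ((N.pathSystem hrank).before r.path) x := by
    obtain ⟨hx, hz⟩ := (hr.uses_iff hdelay).1 hx
    exact h.reserved_eq_used_before (hz ▸ hnext) hx
  convert PackingSystem.isLeast_amount (mem_items_pathSystem (hrank := hrank).2 hr.isPath) using 1
  ext c
  rw [mem_availAlong]
  constructor
  · rintro ⟨x, z, hx, rfl⟩
    exact ⟨x, ((hr.uses_iff hdelay).1 hx).1, by rw [hreserved hx]; rfl⟩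
  · rintro ⟨x, hx, rfl⟩
    exact ⟨x, _, hr.uses_dep hx, by rw [hreserved (hr.uses_dep hx)]; rfl⟩

lemma FillsSlots.slotKey_le_of_isFeasible (h : N.FillsSlots hrank R)
    (hnext : IsGreedyNext (N.slotKey rank) (N.slots hrank) (R.map fun g => N.slot g.1) κ)
    (hr : N.IsFeasible R r) : N.slotKey rank κ ≤ N.slotKey rank (N.slot r) := by
  classical
  by_contra! hlt
  obtain ⟨P, -, hres, x, hx, hfull⟩ := PackingSystem.exists_key_le_isResidual
    (mem_items_pathSystem (hrank := hrank).2 hr.1.isPath)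
  have hv := entry_mem hx
  have hfree := hr.2 _ (mem_availAlong.2 ⟨x, _, hr.1.uses_dep hx, rfl⟩)
  rw [h.reserved_eq, Nat.sub_pos_iff_lt] at hfree
  refine hfree.not_ge (hfull.trans (PackingSystem.used_mono fun Q hQ hxQ hQP => ?_))
  have hresQ := hres.before_of_key_le hQP
  have hvQ := entry_mem hxQ
  refine (hnext.mem_iff _ ((add_suffixTransit_mem_slots_iff hQ hvQ).2 ?_)).2 ?_
  · have hprefix := prefixTransit_le_of_isResidual hresQ hQ hv hvQ
    have hstart := hr.1.dep_source_add_prefixTransit_le hv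
    have hwait := hr.1.arr_le_dep hv
    omega
  · have hdep : N.slotKey rank (r.dep (entry x) + N.suffixTransit r.path (entry x), r.path) ≤
        N.slotKey rank (N.slot r) := slotKey_le_slotKey (hr.1.dep_add_suffixTransit_le hv) le_rfl
    exact (slotKey_add_suffixTransit_le hresQ hQ hv hvQ).trans_lt (hdep.trans_lt hlt)

lemma FillsSlots.exists_isGreedyNext (h : N.FillsSlots hrank R) (hP : N.IsPath P) :
    ∃ κ, IsGreedyNext (N.slotKey rank) (N.slots hrank) (R.map fun g => N.slot g.1) κ :=
  h.isGreedyPrefix.exists_next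
    ((slots_infinite hP).exists_notMem_finite (List.finite_toSet _))

lemma FillsSlots.isGreedyNext_of_routeKey_le (h : N.FillsSlots hrank R) (hr : N.IsFeasible R r)
    (hmin : ∀ r', N.IsFeasible R r' → N.routeKey rank r ≤ N.routeKey rank r') :
    N.delay r = 0 ∧ IsGreedyNext (N.slotKey rank) (N.slots hrank) (R.map fun g => N.slot g.1)
      (N.slot r) := by
  classical
  obtain ⟨⟨a, P⟩, hnext⟩ := h.exists_isGreedyNext hr.1.isPath
  obtain ⟨hP, ha⟩ := hnext.mem
  have hPpath := isPath_of_mem_selected hP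
  have hslot : N.slot (N.directRoute P a) = (a, P) :=
    Prod.ext (directRoute_arr_sink hPpath a) rfl
  have hdirect := isRoute_directRoute hPpath ha
  have hdelay := delay_directRoute hPpath ha
  have hleast := h.isLeast_availAlong hdirect hdelay (hslot.symm ▸ hnext)
  have hkey := slotKey_lt_or_eq_of_routeKey_le (hmin _ ⟨hdirect, fun c hc =>
    (PackingSystem.mem_selected.1 hP).2.trans_le (hleast.2 hc)⟩)
  rw [hslot, hdelay] at hkey
  obtain ⟨heq, hle⟩ := hkey.resolve_left (h.slotKey_le_of_isFeasible hnext hr).not_gt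
  exact ⟨Nat.le_zero.1 hle, N.slotKey_injective hrank heq ▸ hnext⟩

lemma FillsSlots.append (h : N.FillsSlots hrank R) (hr : N.IsRoute r) (hdelay : N.delay r = 0)
    (hnext : IsGreedyNext (N.slotKey rank) (N.slots hrank) (R.map fun g => N.slot g.1)
      (N.slot r)) :
    N.FillsSlots hrank (R ++ [(r, (N.pathSystem hrank).amount r.path)]) where
  isRoute := by simpa [or_imp, forall_and] using ⟨fun g m => h.isRoute (g, m), hr⟩
  delay_eq_zero := by simpa [or_imp, forall_and] using ⟨fun g m => h.delay_eq_zero (g, m), hdelay⟩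
  size_eq := by simpa [or_imp, forall_and] using fun g m => h.size_eq (g, m)
  isGreedyPrefix := by
    simpa using h.isGreedyPrefix.append (N.slotKey_injective hrank) hnext

end Reservations

end EvacNetwork

namespace EvacNetwork

variable {V : Type*} {N : EvacNetwork V} {rank : List V → ℕ} {hrank : Function.Injective rank}
  {r : EvacRoute V} {R : List (EvacRoute V × ℕ)} {p : ℕ}

lemma evacuated_append_singleton (R : List (EvacRoute V × ℕ)) (r : EvacRoute V) (g : ℕ) :
    evacuated (R ++ [(r, g)]) = evacuated R + g := by
  simp [evacuated]

lemma evacTime_append_singleton (h : ∀ g ∈ R, g.1.arr N.sink ≤ r.arr N.sink) :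
    N.evacTime (R ++ [(r, g)]) = r.arr N.sink := by
  induction R with
  | nil => simp [evacTime]
  | cons g' R ih =>
    rw [List.forall_mem_cons] at h
    exact (congrArg (max _) (ih h.2)).trans (max_eq_right h.1)

variable [Finite V]

lemma CCRPReach.fillsSlots (h : N.CCRPReach p rank R) (hlt : evacuated R < p) :
    N.FillsSlots hrank R := by
  induction h with
  | init => exact ⟨by simp, by simp, by simp, IsGreedyPrefix.nil⟩
  | step R r g _ hleft hfeas hmin hgroup ih =>
    have hfill := ih hleft
    obtain ⟨hdelay, hnext⟩ := hfill.isGreedyNext_of_routeKey_le hfeas hmin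
    have hleast := hfill.isLeast_availAlong hfeas.1 hdelay hnext
    obtain rfl : g = (N.pathSystem hrank).amount r.path := by
      rcases hgroup.1 with rfl | hg
      · rw [evacuated_append_singleton] at hlt
        omega
      · exact IsLeast.unique ⟨hg, fun c hc => hgroup.2 (Set.mem_insert_of_mem _ hc)⟩ hleast
    exact hfill.append hfeas.1 hdelay hnext

lemma IsCCRPOutput.exists_fillsSlots (h : N.IsCCRPOutput p rank R) (hp : 0 < p) :
    ∃ R' r g, R = R' ++ [(r, g)] ∧ N.FillsSlots hrank R' ∧
      IsGreedyNext (N.slotKey rank) (N.slots hrank) (R'.map fun g => N.slot g.1) (N.slot r) ∧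
      evacuated R' < p ∧ p ≤ evacuated R' + (N.pathSystem hrank).amount r.path := by
  obtain ⟨hreach, hevac⟩ := h
  cases hreach with
  | init => exact absurd hevac hp.ne
  | step R r g hR hleft hfeas hmin hgroup =>
    have hfill := hR.fillsSlots (hrank := hrank) hleft
    obtain ⟨hdelay, hnext⟩ := hfill.isGreedyNext_of_routeKey_le hfeas hmin
    have hleast := hfill.isLeast_availAlong hfeas.1 hdelay hnext
    refine ⟨R, r, g, rfl, hfill, hnext, hleft, ?_⟩
    rw [← hevac, evacuated_append_singleton]
    exact Nat.add_le_add_left (hgroup.2 (Set.mem_insert_of_mem _ hleast.1)) _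

lemma IsCCRPOutput.path_mem_selected (h : N.IsCCRPOutput p rank R) (hp : 0 < p) {P : List V}
    (hP : P ∈ R.map fun g => g.1.path) : P ∈ (N.pathSystem hrank).selected := by
  obtain ⟨R', r, m, rfl, hfill, hnext, -⟩ := h.exists_fillsSlots (hrank := hrank) hp
  obtain ⟨g, hg, rfl⟩ := List.mem_map.1 hP
  rcases List.mem_append.1 hg with hg | hg
  · exact (hfill.isGreedyPrefix.subset _ (List.mem_map_of_mem hg)).1
  · exact List.mem_singleton.1 hg ▸ hnext.mem.1

/-- The number of people that can arrive at the sink before time `m` when all routes along the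
selected paths are used. The truncated subtraction is intended: paths whose transit time is at least
`m` do not contribute. -/
noncomputable def arrivalsBefore (N : EvacNetwork V) (hrank : Function.Injective rank) (m : ℕ) :
    ℕ :=
  ∑ P ∈ (N.pathSystem hrank).selected, (N.pathSystem hrank).amount P * (m - N.pathTransit P)

lemma arrivalsBefore_mono : Monotone (N.arrivalsBefore hrank) := fun _ _ h =>
  Finset.sum_le_sum fun _ _ => Nat.mul_le_mul_left _ (Nat.sub_le_sub_right h _)

lemma arrivalsBefore_eq_sum_slots (m : ℕ) :
    N.arrivalsBefore hrank m =
      ∑ κ ∈ Finset.range m ×ˢ (N.pathSystem hrank).selected with N.pathTransit κ.2 ≤ κ.1,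
        (N.pathSystem hrank).amount κ.2 := by
  rw [Finset.sum_filter, Finset.sum_product_right]
  refine Finset.sum_congr rfl fun P _ => ?_
  rw [← Finset.sum_filter]
  have hIco : {b ∈ Finset.range m | N.pathTransit P ≤ b} = Finset.Ico (N.pathTransit P) m := by
    ext b
    simp [and_comm]
  change _ = ∑ _b ∈ {b ∈ Finset.range m | N.pathTransit P ≤ b}, (N.pathSystem hrank).amount P
  rw [hIco, Finset.sum_const, Nat.card_Ico, smul_eq_mul, mul_comm]

lemma IsCCRPOutput.arrivalsBefore_evacTime (h : N.IsCCRPOutput p rank R) (hp : 0 < p) :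
    N.arrivalsBefore hrank (N.evacTime R) < p ∧ p ≤ N.arrivalsBefore hrank (N.evacTime R + 1) := by
  classical
  obtain ⟨R', r, g, rfl, hfill, hnext, hlt, hle⟩ := h.exists_fillsSlots (hrank := hrank) hp
  have hprefix := hfill.isGreedyPrefix
  have harr {κ : ℕ × List V} (hκ : κ ∈ R'.map fun g => N.slot g.1) : κ.1 ≤ r.arr N.sink :=
    fst_le_of_slotKey_le ((hnext.mem_iff κ (hprefix.subset κ hκ)).1 hκ).le
  rw [evacTime_append_singleton fun g hg => harr (List.mem_map_of_mem hg),
    arrivalsBefore_eq_sum_slots, arrivalsBefore_eq_sum_slots]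
  rw [hfill.evacuated_eq] at hlt hle
  constructor
  · refine (Finset.sum_le_sum_of_subset fun κ hκ => ?_).trans_lt hlt
    simp only [Finset.mem_filter, Finset.mem_product, Finset.mem_range] at hκ
    refine List.mem_toFinset.2 ((hnext.mem_iff κ ⟨hκ.1.2, hκ.2⟩).2 ?_)
    exact lt_of_not_ge fun hge => (fst_le_of_slotKey_le hge).not_gt hκ.1.1
  · have hsum := Finset.sum_insert (f := fun κ => (N.pathSystem hrank).amount κ.2)
      (mt List.mem_toFinset.1 hnext.notMem)
    rw [add_comm] at hle
    refine (hle.trans hsum.ge).trans (Finset.sum_le_sum_of_subset fun κ hκ => ?_)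
    simp only [Finset.mem_filter, Finset.mem_product, Finset.mem_range, Nat.lt_succ_iff]
    rcases Finset.mem_insert.1 hκ with rfl | hκ
    · exact ⟨⟨le_rfl, hnext.mem.1⟩, hnext.mem.2⟩
    · have hκ := List.mem_toFinset.1 hκ
      exact ⟨⟨harr hκ, (hprefix.subset κ hκ).1⟩, (hprefix.subset κ hκ).2⟩

end EvacNetwork

namespace EvacNetwork

variable {V : Type*} {N : EvacNetwork V} {rank : List V → ℕ} {hrank : Function.Injective rank}
  {S : List (List V × ℕ)} {P Q : List V} {p C : ℕ}

section CombinedEvacuationTime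

lemma le_CET_iff (hne : S ≠ []) (hpos : ∀ a ∈ S, 0 < a.2) (m : ℤ) :
    m ≤ N.CET p S ↔ (S.map fun a => (a.2 : ℤ) * (m - N.pathTransit a.1)).sum < p := by
  have hC : 0 < (S.map Prod.snd).sum :=
    List.sum_pos _ (by simpa using fun C P hP => hpos (P, C) hP) (by simpa using hne)
  have hsum : (S.map fun a => (a.2 : ℤ) * (m - N.pathTransit a.1)).sum =
      m * (S.map Prod.snd).sum - (S.map fun a => a.2 * N.pathTransit a.1).sum := by
    clear hne hpos hC
    induction S with
    | nil => simp
    | cons a S ih =>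
      simp only [List.map_cons, List.sum_cons, ih]
      push_cast
      ring
  rw [CET, le_sub_iff_add_le, Int.add_one_le_iff, Int.lt_ceil, lt_div_iff₀ (by exact_mod_cast hC),
    hsum, sub_lt_iff_lt_add]
  generalize (S.map Prod.snd).sum = D, (S.map fun a => a.2 * N.pathTransit a.1).sum = E
  rw [← Int.cast_lt (R := ℚ)]
  push_cast
  rfl

lemma pathTransit_le_CET_append (hp : 0 < p) (hpos : ∀ a ∈ S, 0 < a.2) (hC : 0 < C)
    (hP : S ≠ [] → N.pathTransit P ≤ N.CET p S) :
    (N.pathTransit P : ℤ) ≤ N.CET p (S ++ [(P, C)]) := by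
  rw [le_CET_iff (by simp) (by simpa [or_imp, forall_and] using ⟨fun P m => hpos (P, m), hC⟩)]
  rcases eq_or_ne S [] with rfl | hne
  · simpa using hp
  · simpa using (le_CET_iff hne hpos _).1 (hP hne)

end CombinedEvacuationTime

section Selection

open Classical in
/-- The capacity of the node or edge `x` that has been deducted for the paths in `S`. -/
noncomputable def deducted (S : List (List V × ℕ)) (x : V ⊕ V × V) : ℕ :=
  (S.map fun a => if x ∈ resources a.1 then a.2 else 0).sum

lemma residualAlong_eq (N : EvacNetwork V) (S : List (List V × ℕ)) (P : List V) :
    N.residualAlong S P = (fun x => N.cap x - deducted S x) '' resources P := by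
  have hnode (v : V) : N.residualNode S v = N.cap (.inl v) - deducted S (.inl v) := by
    simp only [residualNode, deducted, cap, Sum.elim_inl, inl_mem_resources]
    congr!
  have hedge (e : V × V) : N.residualEdge S e = N.cap (.inr e) - deducted S (.inr e) := by
    simp only [residualEdge, deducted, cap, Sum.elim_inr, inr_mem_resources]
    congr!
  ext c
  simp [residualAlong, hnode, hedge, eq_comm]

variable [Finite V]

/-- The paths in `S` are the first ones of the greedy packing, with their capacities. -/
structure SelectsGreedily (N : EvacNetwork V) (hrank : Function.Injective rank)
    (S : List (List V × ℕ)) : Prop where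
  isGreedyPrefix :
    IsGreedyPrefix (N.pathKey rank) (N.pathSystem hrank).selected (S.map Prod.fst)
  capacity_eq : ∀ a ∈ S, a.2 = (N.pathSystem hrank).amount a.1

lemma SelectsGreedily.mem_selected (h : N.SelectsGreedily hrank S) {a : List V × ℕ} (ha : a ∈ S) :
    a.1 ∈ (N.pathSystem hrank).selected :=
  h.isGreedyPrefix.subset _ (List.mem_map_of_mem ha)

lemma SelectsGreedily.capacity_pos (h : N.SelectsGreedily hrank S) {a : List V × ℕ} (ha : a ∈ S) :
    0 < a.2 :=
  h.capacity_eq a ha ▸ (PackingSystem.mem_selected.1 (h.mem_selected ha)).2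

lemma SelectsGreedily.sum_map [DecidableEq V] (h : N.SelectsGreedily hrank S) (f : List V → ℕ → ℕ) :
    (S.map fun a => f a.1 a.2).sum =
      ∑ Q ∈ (S.map Prod.fst).toFinset, f Q ((N.pathSystem hrank).amount Q) := by
  rw [List.sum_toFinset _ h.isGreedyPrefix.nodup, List.map_map]
  refine congrArg List.sum (List.map_congr_left fun a ha => ?_)
  rw [h.capacity_eq a ha]
  rfl

lemma SelectsGreedily.deducted_eq (h : N.SelectsGreedily hrank S) (x : V ⊕ V × V) :
    deducted S x = (N.pathSystem hrank).used {Q | Q ∈ S.map Prod.fst} x := by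
  classical
  rw [deducted, h.sum_map fun Q C => if x ∈ resources Q then C else 0, ← Finset.sum_filter,
    PackingSystem.used]
  refine Finset.sum_congr (Finset.ext fun Q => ?_) fun _ _ => rfl
  simp only [Finset.mem_filter, List.mem_toFinset]
  exact ⟨fun hQ => ⟨(PackingSystem.mem_selected.1 (h.isGreedyPrefix.subset Q hQ.1)).1, hQ⟩,
    And.right⟩

lemma SelectsGreedily.isResidualPath_iff (h : N.SelectsGreedily hrank S) :
    N.IsResidualPath S P ↔ (N.pathSystem hrank).IsResidual {Q | Q ∈ S.map Prod.fst} P := by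
  rw [IsResidualPath, residualAlong_eq, Set.forall_mem_image]
  simp only [h.deducted_eq, Nat.sub_pos_iff_lt]
  exact and_congr_left' mem_items_pathSystem.symm

lemma SelectsGreedily.isLeast_residualAlong (h : N.SelectsGreedily hrank S)
    (hP : IsGreedyNext (N.pathKey rank) (N.pathSystem hrank).selected (S.map Prod.fst) P) :
    IsLeast (N.residualAlong S P) ((N.pathSystem hrank).amount P) := by
  rw [residualAlong_eq]
  simp only [h.deducted_eq, PackingSystem.used_eq_used_before (G := N.pathSystem hrank) hP]
  exact PackingSystem.isLeast_amount (PackingSystem.mem_selected.1 hP.mem).1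

lemma SelectsGreedily.ssepStep_iff (h : N.SelectsGreedily hrank S) :
    N.SSEPStep p rank S P C ↔
      (S.length < p ∧ (S ≠ [] → (N.pathTransit P : ℤ) ≤ N.CET p S)) ∧
      IsGreedyNext (N.pathKey rank) (N.pathSystem hrank).selected (S.map Prod.fst) P ∧
        C = (N.pathSystem hrank).amount P := by
  have hnext := PackingSystem.isGreedyNext_iff (G := N.pathSystem hrank) (i := P) h.isGreedyPrefix
  simp only [← h.isResidualPath_iff] at hnext
  constructor
  · intro hstep
    have hP := hnext.2 ⟨hstep.residual, hstep.shortest⟩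
    exact ⟨⟨hstep.length_lt, hstep.transit_le⟩, hP,
      hstep.capacity.unique (h.isLeast_residualAlong hP)⟩
  · rintro ⟨⟨hlength, htransit⟩, hP, rfl⟩
    exact ⟨hlength, (hnext.1 hP).1, (hnext.1 hP).2, h.isLeast_residualAlong hP, htransit⟩

lemma SelectsGreedily.append (h : N.SelectsGreedily hrank S)
    (hP : IsGreedyNext (N.pathKey rank) (N.pathSystem hrank).selected (S.map Prod.fst) P) :
    N.SelectsGreedily hrank (S ++ [(P, (N.pathSystem hrank).amount P)]) where
  isGreedyPrefix := by simpa using h.isGreedyPrefix.append (N.pathKey_injective hrank) hP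
  capacity_eq := by simpa [or_imp, forall_and] using fun Q C => h.capacity_eq (Q, C)

lemma SSEPReach.selectsGreedily (h : N.SSEPReach p rank S) : N.SelectsGreedily hrank S := by
  induction h with
  | init => exact ⟨IsGreedyPrefix.nil, by simp⟩
  | step S P C _ hstep ih =>
    obtain ⟨-, hP, rfl⟩ := ih.ssepStep_iff.1 hstep
    exact ih.append hP

lemma SSEPReach.pathTransit_le_CET (hrank : Function.Injective rank) (h : N.SSEPReach p rank S)
    (hp : 0 < p) {a : List V × ℕ} (ha : a ∈ S) : (N.pathTransit a.1 : ℤ) ≤ N.CET p S := by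
  cases h with
  | init => simp at ha
  | step S P C hS hstep =>
    have hsel := hS.selectsGreedily (hrank := hrank)
    obtain ⟨⟨-, htransit⟩, hP, rfl⟩ := hsel.ssepStep_iff.1 hstep
    have hle : N.pathTransit a.1 ≤ N.pathTransit P := by
      rcases List.mem_append.1 ha with ha | ha
      · exact pathTransit_le_of_pathKey_le
          ((hP.mem_iff _ (hsel.mem_selected ha)).1 (List.mem_map_of_mem ha)).le
      · rw [List.mem_singleton.1 ha]
    exact (Nat.cast_le.2 hle).trans (pathTransit_le_CET_append hp (fun _ => hsel.capacity_pos)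
      (PackingSystem.mem_selected.1 hP.mem).2 htransit)

end Selection

section Output

variable [Finite V]

lemma IsSSEPOutput.ne_nil (h : N.IsSSEPOutput p rank S) (hrank : Function.Injective rank)
    (hp : 0 < p) (hP : N.IsPath P) : S ≠ [] := by
  rintro rfl
  have hsel := h.1.selectsGreedily (hrank := hrank)
  obtain ⟨Q, hQ⟩ :=
    PackingSystem.selected_nonempty ⟨P, mem_items_pathSystem (hrank := hrank).2 hP⟩
  obtain ⟨P', hP'⟩ := hsel.isGreedyPrefix.exists_next ⟨Q, hQ, List.not_mem_nil⟩
  exact h.2 P' _ (hsel.ssepStep_iff.2 ⟨⟨hp, fun hne => absurd rfl hne⟩, hP', rfl⟩)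

lemma SSEPReach.exists_CET_eq [DecidableEq V] (h : N.SSEPReach p rank S)
    (hrank : Function.Injective rank) (hp : 0 < p) (hne : S ≠ []) :
    ∃ e : ℕ, N.CET p S = e ∧
      ∑ Q ∈ (S.map Prod.fst).toFinset,
        (N.pathSystem hrank).amount Q * (e - N.pathTransit Q) < p := by
  have hsel := h.selectsGreedily (hrank := hrank)
  obtain ⟨a, ha⟩ := List.exists_mem_of_ne_nil S hne
  obtain ⟨e, he⟩ :=
    Int.eq_ofNat_of_zero_le ((Nat.cast_nonneg _).trans (h.pathTransit_le_CET hrank hp ha))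
  refine ⟨e, he, ?_⟩
  rw [← hsel.sum_map fun Q C => C * (e - N.pathTransit Q)]
  have hlt := (le_CET_iff hne (fun _ => hsel.capacity_pos) e).1 he.ge
  rw [← Nat.cast_lt (α := ℤ), Nat.cast_list_sum, List.map_map]
  refine lt_of_eq_of_lt (congrArg List.sum (List.map_congr_left fun b hb => ?_)) hlt
  have hb := h.pathTransit_le_CET hrank hp hb
  rw [he, Nat.cast_le] at hb
  simp [Nat.cast_sub hb]

lemma IsSSEPOutput.le_pathTransit_of_notMem [DecidableEq V] (h : N.IsSSEPOutput p rank S) {e : ℕ}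
    (he : N.CET p S = e)
    (hsum : ∑ Q ∈ (S.map Prod.fst).toFinset,
      (N.pathSystem hrank).amount Q * (e - N.pathTransit Q) < p)
    (hQ : Q ∈ (N.pathSystem hrank).selected) (hQS : Q ∉ S.map Prod.fst) :
    e ≤ N.pathTransit Q := by
  have hsel := h.1.selectsGreedily (hrank := hrank)
  obtain ⟨P, hP⟩ := hsel.isGreedyPrefix.exists_next ⟨Q, hQ, hQS⟩
  have hPQ : N.pathKey rank P ≤ N.pathKey rank Q := not_lt.1 (mt (hP.mem_iff Q hQ).2 hQS)
  by_contra! hlt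
  have hPe : N.pathTransit P < e := (pathTransit_le_of_pathKey_le hPQ).trans_lt hlt
  have hlength : p ≤ S.length := by
    by_contra! hlength
    refine h.2 P _ (hsel.ssepStep_iff.2 ⟨⟨hlength, fun _ => ?_⟩, hP, rfl⟩)
    exact he ▸ Nat.cast_le.2 hPe.le
  refine hsum.not_ge (hlength.trans ?_)
  rw [← List.length_map Prod.fst, ← List.toFinset_card_of_nodup hsel.isGreedyPrefix.nodup,
    Finset.card_eq_sum_ones]
  refine Finset.sum_le_sum fun P' hP' => ?_
  have hP' := List.mem_toFinset.1 hP'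
  have hsel' := hsel.isGreedyPrefix.subset P' hP'
  have hle := pathTransit_le_of_pathKey_le ((hP.mem_iff P' hsel').1 hP').le
  exact Nat.mul_pos (PackingSystem.mem_selected.1 hsel').2 (Nat.sub_pos_of_lt (hle.trans_lt hPe))

lemma IsSSEPOutput.exists_CET_eq (h : N.IsSSEPOutput p rank S) (hrank : Function.Injective rank)
    (hp : 0 < p) (hne : S ≠ []) :
    ∃ e : ℕ, N.CET p S = e ∧ N.arrivalsBefore hrank e < p := by
  classical
  obtain ⟨e, he, hsum⟩ := h.1.exists_CET_eq hrank hp hne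
  refine ⟨e, he, lt_of_eq_of_lt (Finset.sum_subset (fun Q hQ => ?_) fun Q hQ hQS => ?_).symm hsum⟩
  · exact h.1.selectsGreedily.isGreedyPrefix.subset Q (List.mem_toFinset.1 hQ)
  · rw [Nat.sub_eq_zero_of_le
      (h.le_pathTransit_of_notMem he hsum hQ (mt List.mem_toFinset.2 hQS)), mul_zero]

end Output

end EvacNetwork

namespace EvacNetwork

lemma le_evacBound {V : Type*} [Fintype V] {N : EvacNetwork V} {rank : List V → ℕ}
    {hrank : Function.Injective rank} {U : Finset (List V)} {m p : ℕ} (hτ : 0 < N.maxTransit)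
    (hne : U.Nonempty) (hU : U ⊆ (N.pathSystem hrank).selected)
    (hm : N.arrivalsBefore hrank m < p) : (m : ℤ) ≤ N.evacBound p U.card := by
  have harrivals : ∑ Q ∈ U, (m - N.pathTransit Q) ≤ N.arrivalsBefore hrank m :=
    (Finset.sum_le_sum_of_subset hU).trans <| Finset.sum_le_sum fun Q hQ =>
      Nat.le_mul_of_pos_left _ (PackingSystem.mem_selected.1 hQ).2
  have hsum : U.card * m ≤ ∑ Q ∈ U, (m - N.pathTransit Q) + ∑ Q ∈ U, N.pathTransit Q := by
    rw [← Finset.sum_add_distrib, ← smul_eq_mul]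
    exact Finset.card_nsmul_le_sum _ _ _ fun Q _ => le_tsub_add
  have htransit := sum_pathTransit_add_card_le hτ hU
  have hn : 1 ≤ Fintype.card V := Fintype.card_pos_iff.2 ⟨N.source⟩
  have hbound : U.card * m + U.card ≤ p + U.card * ((Fintype.card V - 1) * N.maxTransit) := by
    omega
  have hfloor : (m : ℤ) + 1 - ((Fintype.card V : ℤ) - 1) * N.maxTransit ≤ ⌊(p : ℚ) / U.card⌋ := by
    rw [Int.le_floor, le_div_iff₀ (by exact_mod_cast hne.card_pos)]
    zify [hn] at hbound
    have hmul : ((m : ℤ) + 1 - ((Fintype.card V : ℤ) - 1) * N.maxTransit) * U.card ≤ p := by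
      linarith
    exact_mod_cast hmul
  rw [evacBound]
  linarith

end EvacNetwork

/-- Upper bound on the evacuation time of CCRP, and of SSEP, in a single-source single-sink
network; `rank` is the fixed ranking of paths by which both break ties. -/
theorem mainTheorem3 {V : Type*} [Fintype V] [DecidableEq V] (N : EvacNetwork V)
    (hτ : 0 < N.maxTransit) (p : ℕ) (hp : 0 < p)
    (rank : List V → ℕ) (hrank : Function.Injective rank)
    (R : List (EvacRoute V × ℕ)) (hR : N.IsCCRPOutput p rank R)
    (S : List (List V × ℕ)) (hS : N.IsSSEPOutput p rank S) :
    (N.evacTime R : ℤ) ≤ N.evacBound p (EvacNetwork.numPaths R) ∧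
    N.CET p S ≤ N.evacBound p (EvacNetwork.numPaths R) ∧
    N.CET p S ≤ N.evacBound p S.length := by
  obtain ⟨hbefore, hafter⟩ := hR.arrivalsBefore_evacTime (hrank := hrank) hp
  have hRsel : (R.map fun g => g.1.path).toFinset ⊆ (N.pathSystem hrank).selected :=
    fun _ hP => hR.path_mem_selected hp (List.mem_toFinset.1 hP)
  have hRne : (R.map fun g => g.1.path).toFinset.Nonempty := by
    rw [List.toFinset_nonempty_iff, ne_eq, List.map_eq_nil_iff]
    rintro rfl
    exact hp.ne hR.2
  obtain ⟨P, hP⟩ := hRne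
  have hSne := hS.ne_nil hrank hp (EvacNetwork.isPath_of_mem_selected (hRsel hP))
  obtain ⟨e, he, hlt⟩ := hS.exists_CET_eq hrank hp hSne
  have hCCRP := EvacNetwork.le_evacBound hτ ⟨P, hP⟩ hRsel hbefore
  have hle : e ≤ N.evacTime R :=
    Nat.lt_succ_iff.1 (EvacNetwork.arrivalsBefore_mono.reflect_lt (hlt.trans_le hafter))
  have hSgreedy := (hS.1.selectsGreedily (hrank := hrank)).isGreedyPrefix
  have hSSEP := EvacNetwork.le_evacBound (U := (S.map Prod.fst).toFinset) hτ
    (by simpa using hSne) (fun Q hQ => hSgreedy.subset Q (List.mem_toFinset.1 hQ)) hlt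
  rw [List.toFinset_card_of_nodup hSgreedy.nodup, List.length_map] at hSSEP
  exact ⟨hCCRP, he ▸ (Nat.cast_le.2 hle).trans hCCRP, he ▸ hSSEP⟩
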